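/- Let $d\ge 0$ be an integer, $\mathbb T=\mathbb R/2\pi\mathbb Z$, let $I\subset\mathbb R$ be an open interval and, for $r\in I$, let $D_r\subset\mathbb R^d\times\mathbb R^d$ be such that $$\Omega=\{z=(\theta,q,r,p):\ \theta\in\mathbb T,\ r\in I,\ (q,p)\in D_r\}$$ is open in $\mathbb T\times\mathbb R^d\times\mathbb R\times\mathbb R^d$. Let $h\in C^3(I)$ and let $U=U(t,\theta,q,r,p)$ be a real function on $\mathbb T\times\Omega$ that is three times differentiable in $z=(\theta,q,r,p)$, all derivatives in $z$ of order at most $3$ (including $U$ itself) being continuous in $(t,z)$. For a real parameter $\varepsilon$ consider the Hamiltonian system with Hamiltonian $K_\varepsilon(t,z)=h(r)-\varepsilon U(t,\theta,q,r,p)$, $$\dot\theta=h'(r)-\varepsilon\,\partial_rU,\qquad \dot q=-\varepsilon\,\partial_pU,\qquad \dot r=\varepsilon\,\partial_\theta U,\qquad \dot p=\varepsilon\,\partial_qU, \qquad (1)$$ and write it as $\dot z=X_\varepsilon(t,z)$. Let $N\in\mathbb Z$ and $r_N\in I$ satisfy $h'(r_N)=N$ and $h''(r_N)\ne 0$, and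 put $$U_\#(\theta,q,p)=\frac1{2\pi}\int_0^{2\pi}U(t,\theta+Nt,q,r_N,p)\,dt,\qquad \theta\in\mathbb T,\ (q,p)\in D_{r_N}.$$ Let $\varepsilon_0>0$ and let $z(t,\varepsilon)=(\theta,q,r,p)(t,\varepsilon)$, $t\in\mathbb R$, $|\varepsilon|<\varepsilon_0$, be a family of class $C^1$ in $(t,\varepsilon)$ such that for each $\varepsilon$ the function $t\mapsto z(t,\varepsilon)$ is a $2\pi$-periodic solution of (1) in $\Omega$ (the angle $\theta$ being understood modulo $2\pi$), and $$z(t,0)=(\theta_*+Nt,\ q_*,\ r_N,\ p_*)\qquad(t\in\mathbb R).$$ Assume that at least one of the following two conditions holds: $$h''(r_N)\,\partial^2_{\theta\theta}U_\#(\theta_*,q_*,p_*)>0,\qquad\qquad h''(r_N)\,\det\left[D^2U_\#(\theta_*,q_*,p_*)\right]>0,$$ where $D^2U_\#$ is the Hessian matrix with respect to $(\theta,q,p)$. Then there is $\varepsilon_1\in(0,\varepsilon_0]$ such that for every $\varepsilon\in(0,\varepsilon_1)$: 1. some Floquet multiplier $\mu\in\mathbb C$ of $z(\cdot,\varepsilon)$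 satisfies $|\mu|>1$, where the Floquet multipliers are the eigenvalues of $\Phi(2\pi)$, $\Phi$ being the matrix solution of the variational equation $\dot\Phi=D_zX_\varepsilon(t,z(t,\varepsilon))\,\Phi$ with $\Phi(0)$ the identity; 2. the solution $z(\cdot,\varepsilon)$ is unstable in the sense of Lyapunov, that is, it is not true that for every $\eta>0$ there is $\delta>0$ such that every solution of (1) in $\Omega$ starting at time $0$ at distance less than $\delta$ from $z(0,\varepsilon)$ exists for all $t\ge0$ and stays at distance less than $\eta$ from $z(t,\varepsilon)$. -/

import Mathlib

open Set Filter Topology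

noncomputable section

namespace DegenerateHamiltonian

/-- Phase points `z = (θ, q, r, p)` with `q, p ∈ ℝ^d`. The angle `θ` is represented by a real lift;
functions on the phase space are `2π`-periodic in `θ`. (The product norm is equivalent to the
Euclidean one; only the topology and the differentiable structure are used.) -/
abbrev Phase (d : ℕ) : Type := ℝ × (Fin d → ℝ) × ℝ × (Fin d → ℝ)

/-- The phase space `Ω = {(θ, q, r, p) : r ∈ I, (q, p) ∈ D_r}` (lifted in `θ`). -/
def phaseSpace {d : ℕ} (I : Set ℝ) (D : ℝ → Set ((Fin d → ℝ) × (Fin d → ℝ))) : Set (Phase d) :=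
  {z | z.2.2.1 ∈ I ∧ (z.2.1, z.2.2.2) ∈ D z.2.2.1}

/-- The class `C^{0,3}(𝕋 × Ω)`: `2π`-periodic in the time and in the angle, three times
differentiable in the phase variable, all derivatives of order at most three being continuous in
`(t, z)` jointly. It is meant for open `Ω`. -/
structure IsC03 {d : ℕ} (U : ℝ → Phase d → ℝ) (Ω : Set (Phase d)) : Prop where
  periodic_time : ∀ t, ∀ z ∈ Ω, U (t + 2 * Real.pi) z = U t z
  periodic_angle : ∀ t, ∀ z ∈ Ω, U t (z.1 + 2 * Real.pi, z.2) = U t z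
  contDiffOn : ∀ t, ContDiffOn ℝ 3 (U t) Ω
  continuousOn : ∀ k ≤ 3,
    ContinuousOn (fun x : ℝ × Phase d => iteratedFDeriv ℝ k (U x.1) x.2) (univ ×ˢ Ω)

/-- The Hamiltonian `K_ε(t, θ, q, r, p) = h(r) - ε U(t, θ, q, r, p)`. -/
def hamiltonian {d : ℕ} (h : ℝ → ℝ) (U : ℝ → Phase d → ℝ) (ε t : ℝ) (z : Phase d) : ℝ :=
  h z.2.2.1 - ε * U t z

/-- The Hamiltonian vector field `J ∇ K = (∂_r K, ∂_p K, -∂_θ K, -∂_q K)` for the symplectic form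
`dθ ∧ dr + ∑ dq_i ∧ dp_i`. -/
def hamiltonianField {d : ℕ} (K : Phase d → ℝ) (z : Phase d) : Phase d :=
  (fderiv ℝ K z (0, 0, 1, 0),
   fun i => fderiv ℝ K z (0, 0, 0, Pi.single i 1),
   -fderiv ℝ K z (1, 0, 0, 0),
   fun i => -fderiv ℝ K z (0, Pi.single i 1, 0, 0))

/-- The time-dependent vector field of the perturbed system. On `Ω` it reads
`θ' = h'(r) - ε ∂_r U`, `q' = -ε ∂_p U`, `r' = ε ∂_θ U`, `p' = ε ∂_q U`. -/
def field {d : ℕ} (h : ℝ → ℝ) (U : ℝ → Phase d → ℝ) (ε t : ℝ) : Phase d → Phase d :=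
  hamiltonianField (hamiltonian h U ε t)

/-- `z` is a solution, defined for all times and contained in `Ω`, of `z' = X(t, z)`, that is
`2π`-periodic on `𝕋 × ℝ^d × ℝ × ℝ^d`: the angle has to return modulo `2π` only. -/
structure IsPeriodicSolution {d : ℕ} (X : ℝ → Phase d → Phase d) (Ω : Set (Phase d))
    (z : ℝ → Phase d) : Prop where
  mem : ∀ t, z t ∈ Ω
  hasDerivAt : ∀ t, HasDerivAt z (X t (z t)) t
  periodic_angle : ∀ t, ((z (t + 2 * Real.pi)).1 : Real.Angle) = ((z t).1 : Real.Angle)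
  periodic : ∀ t, (z (t + 2 * Real.pi)).2 = (z t).2

/-- The averaged function
`U_#(θ, q, p) = (1 / 2π) ∫_0^{2π} U(t, θ + N t, q, r_N, p) dt`. -/
def average {d : ℕ} (U : ℝ → Phase d → ℝ) (N : ℤ) (rN : ℝ)
    (x : ℝ × (Fin d → ℝ) × (Fin d → ℝ)) : ℝ :=
  (1 / (2 * Real.pi)) *
    ∫ t in (0 : ℝ)..(2 * Real.pi), U t (x.1 + N * t, x.2.1, rN, x.2.2)

/-- The standard basis of the space of the variables `(θ, q, p)`. -/
def stdVec {d : ℕ} : Unit ⊕ Fin d ⊕ Fin d → ℝ × (Fin d → ℝ) × (Fin d → ℝ)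
  | Sum.inl _ => (1, 0, 0)
  | Sum.inr (Sum.inl i) => (0, Pi.single i 1, 0)
  | Sum.inr (Sum.inr i) => (0, 0, Pi.single i 1)

/-- The Hessian matrix `D² f` with respect to `(θ, q, p)`. -/
def hessian {d : ℕ} (f : ℝ × (Fin d → ℝ) × (Fin d → ℝ) → ℝ)
    (x : ℝ × (Fin d → ℝ) × (Fin d → ℝ)) :
    Matrix (Unit ⊕ Fin d ⊕ Fin d) (Unit ⊕ Fin d ⊕ Fin d) ℝ :=
  Matrix.of fun i j => fderiv ℝ (fun y => fderiv ℝ f y (stdVec j)) x (stdVec i)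

/-- The second derivative `∂²f / ∂θ²`. -/
def secondAngleDeriv {d : ℕ} (f : ℝ × (Fin d → ℝ) × (Fin d → ℝ) → ℝ)
    (x : ℝ × (Fin d → ℝ) × (Fin d → ℝ)) : ℝ :=
  hessian f x (Sum.inl ()) (Sum.inl ())

/-- The coefficient `A(t) = D_z X(t, z(t))` of the variational equation `δ' = A(t) δ` along `z`. -/
def variationalCoeff {d : ℕ} (X : ℝ → Phase d → Phase d) (z : ℝ → Phase d) (t : ℝ) :
    Phase d →L[ℝ] Phase d :=
  fderiv ℝ (X t) (z t)

/-- `μ` is a Floquet multiplier of the `2π`-periodic linear equation `δ' = A(t) δ`: a complex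
eigenvalue of the monodromy matrix `Φ(2π)`, where `Φ' = A(t) Φ` and `Φ(0)` is the identity. -/
def IsFloquetMultiplier {d : ℕ} (A : ℝ → Phase d →L[ℝ] Phase d) (μ : ℂ) : Prop :=
  ∃ Φ : ℝ → Phase d →L[ℝ] Phase d,
    Φ 0 = ContinuousLinearMap.id ℝ (Phase d) ∧
    (∀ t, HasDerivAt Φ ((A t).comp (Φ t)) t) ∧
    (((Φ (2 * Real.pi) : Phase d →ₗ[ℝ] Phase d).charpoly).map (algebraMap ℝ ℂ)).IsRoot μ

/-- Lyapunov stability of the solution `z` of `z' = X(t, z)` in `Ω`: solutions that start close to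
`z(0)` exist for all future times and stay close to `z`. (Measuring the angle in its lift or modulo
`2π` gives the same notion, because a solution that stays within a distance less than `π` modulo
`2π` stays so in the lift, by continuity.) -/
def LyapunovStable {d : ℕ} (X : ℝ → Phase d → Phase d) (Ω : Set (Phase d))
    (z : ℝ → Phase d) : Prop :=
  ∀ η > 0, ∃ δ > 0, ∀ w₀ ∈ Ω, dist w₀ (z 0) < δ →
    ∃ w : ℝ → Phase d, w 0 = w₀ ∧
      (∀ t, 0 ≤ t → w t ∈ Ω ∧ HasDerivWithinAt w (X t (w t)) (Ici 0) t) ∧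
      ∀ t, 0 ≤ t → dist (w t) (z t) < η

end DegenerateHamiltonian

end

/-! Write `α = h''(r_N)`. Along the family the variational equation is `Φ' = (h''(r) 𝒩 - ε J D²U)
Φ`, where `𝒩 = ∂_θ ⊗ dr` satisfies `𝒩² = 0`. For `ε = 0` the monodromy is `1 + 2πα 𝒩`, all
multipliers equal 1, and the question is how the perturbation splits this multiple eigenvalue.

The limit flow `1 + tα𝒩` is explicit, and Gronwall comparisons give the monodromy to the required
order: a limit of order one, which differs from the identity only in the passage from `r` to `θ`,
and, for any linear form killing `∂_θ`, a first order coefficient in `ε`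
(`tendsto_inv_smul_monodromy`). On vectors without `r`-component these coefficients are integrals of
`D²U` along the resonant orbit, that is, `2π D²U_#` (`hessian_average`).

Each condition makes the characteristic polynomial `χ` of the monodromy `M` negative at some `x ≥
1`; as `χ` is monic, it has a real root beyond `x`. Determinant condition, at `x = 1`: `J⁻¹` has
positive determinant, and in `J⁻¹(1 - M)` the `r`-row tends to `-2πα` on the diagonal and 0
elsewhere, while the other rows are of order `ε` with the averaged Hessian as leading block. So
`χ(1)` has the sign of `-α det D²U_#`. Angle condition, at `x = 1 + √ε ν`: in the plane `(r, θ)`, `M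
- 1` is to leading order antidiagonal, with entries `2πε ∂²_θθ U_#` and `2πα`, so eigenvalues `±2π
√(ε α ∂²_θθ U_#)` are expected. Rescaling rows and columns by powers of `√ε` shows that `χ(x) < 0`
whenever `ν² < 4π² α ∂²_θθ U_#`.

A multiplier outside the unit disc gives Lyapunov instability by a discrete argument on the period
map (`exists_escape_of_growth`). It needs no invariant splitting: orbits growing exactly like the
powers of the spectral radius `a` beat the accumulated quadratic errors, since `‖M ^ k‖ ≤ C b ^ k`
for some `b < a²`. Compactness over one period supplies the uniform quadratic estimates. -/

namespace DegenerateHamiltonian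

set_option maxSynthPendingDepth 3

/-! ### Global solutions of linear equations by the Dyson series -/

section LinearODE

variable {R : Type*} [NormedRing R] [NormedAlgebra ℝ R]

/-- The terms of the Dyson series of the linear equation `Φ' = A(t) Φ`, `Φ(0) = 1`. -/
noncomputable def dysonTerm (A : ℝ → R) : ℕ → ℝ → R
  | 0 => fun _ => 1
  | n + 1 => fun t => ∫ s in (0 : ℝ)..t, A s * dysonTerm A n s

lemma continuous_dysonTerm {A : ℝ → R} (hA : Continuous A) (n : ℕ) :
    Continuous (dysonTerm A n) := by
  induction n with
  | zero => exact continuous_const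
  | succ n ih =>
    exact intervalIntegral.continuous_primitive
      (fun a b => (hA.mul ih).intervalIntegrable a b) 0

lemma hasDerivAt_dysonTerm [CompleteSpace R] {A : ℝ → R} (hA : Continuous A) (n : ℕ) (t : ℝ) :
    HasDerivAt (dysonTerm A (n + 1)) (A t * dysonTerm A n t) t :=
  (hA.mul (continuous_dysonTerm hA n)).integral_hasStrictDerivAt 0 t |>.hasDerivAt

/-- Iterated integration over a simplex: the terms are dominated by those of the scalar exponential
series. -/
lemma norm_dysonTerm_le {A : ℝ → R} {ρ L : ℝ}
    (hL : ∀ t, |t| ≤ ρ → ‖A t‖ ≤ L) (n : ℕ) {t : ℝ} (ht : |t| ≤ ρ) :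
    ‖dysonTerm A n t‖ ≤ ‖(1 : R)‖ * (L ^ n / n.factorial * |t| ^ n) := by
  induction n generalizing t with
  | zero => simp [dysonTerm]
  | succ n ih =>
    have hL0 : 0 ≤ L := (norm_nonneg _).trans (hL t ht)
    have hsub : ∀ s ∈ uIoc 0 t, |s| ≤ |t| := fun s hs => by
      rcases mem_uIoc.1 hs with h | h
      · rw [abs_of_pos h.1, abs_of_nonneg (h.1.le.trans h.2)]; exact h.2
      · rw [abs_of_nonpos h.2, abs_of_neg (h.1.trans_le h.2)]; linarith [h.1]
    calc ‖dysonTerm A (n + 1) t‖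
        ≤ |∫ s in (0 : ℝ)..t, L * (‖(1 : R)‖ * (L ^ n / n.factorial * |s - 0| ^ n))| := by
          refine intervalIntegral.norm_integral_le_abs_of_norm_le ?_ ?_
          · refine (MeasureTheory.ae_restrict_mem measurableSet_uIoc).mono fun s hs => ?_
            have := (hsub s hs).trans ht
            rw [sub_zero]
            exact (norm_mul_le _ _).trans
              (mul_le_mul (hL s this) (ih this) (norm_nonneg _) hL0)
          · exact Continuous.intervalIntegrable (by fun_prop) _ _
      _ = _ := by
          simp only [intervalIntegral.integral_const_mul, abs_mul,
            intervalIntegral.abs_intervalIntegral_eq, integral_pow_abs_sub_uIoc]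
          rw [abs_of_nonneg hL0, abs_of_nonneg (norm_nonneg _), abs_of_nonneg (by positivity),
            abs_of_nonneg (by positivity), Nat.factorial_succ]
          push_cast
          rw [sub_zero]
          field_simp
          ring

/-- Global existence for linear equations with continuous coefficients. -/
lemma exists_fundamental_solution [CompleteSpace R] {A : ℝ → R} (hA : Continuous A) :
    ∃ Φ : ℝ → R, Φ 0 = 1 ∧ ∀ t, HasDerivAt Φ (A t * Φ t) t := by
  refine ⟨fun t => ∑' n, dysonTerm A n t, ?_, fun t => ?_⟩
  · dsimp only
    rw [tsum_eq_single 0]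
    · rfl
    · rintro (_ | n) hn
      · exact absurd rfl hn
      · simp [dysonTerm]
  -- The radius `|t| + 1` leaves a neighbourhood of `t` on which the series and its term-by-term
  -- derivative are uniformly dominated.
  · obtain ⟨L, hL⟩ := (isCompact_closedBall (0 : ℝ) (|t| + 1)).exists_bound_of_continuousOn
      hA.continuousOn
    have hL' : ∀ s, |s| ≤ |t| + 1 → ‖A s‖ ≤ L := fun s hs => hL s (by simpa using hs)
    have hL0 : 0 ≤ L := (norm_nonneg _).trans (hL' t (by linarith))
    have hsum : Summable fun n : ℕ => ‖(1 : R)‖ * ((L * (|t| + 1)) ^ n / n.factorial) :=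
      (Real.summable_pow_div_factorial _).mul_left _
    have hbound : ∀ n s, |s| ≤ |t| + 1 →
        ‖dysonTerm A n s‖ ≤ ‖(1 : R)‖ * ((L * (|t| + 1)) ^ n / n.factorial) := fun n s hs => by
      refine (norm_dysonTerm_le hL' n hs).trans ?_
      rw [mul_pow, mul_div_right_comm]
      gcongr
    have hs : ∀ s, |s| ≤ |t| + 1 → Summable fun n => dysonTerm A n s := fun s h =>
      Summable.of_norm_bounded hsum fun n => hbound n s h
    have htb : t ∈ Metric.ball (0 : ℝ) (|t| + 1) := by simp
    have hder : HasDerivAt (fun s => ∑' n, dysonTerm A (n + 1) s)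
        (∑' n, A t * dysonTerm A n t) t := by
      refine hasDerivAt_tsum_of_isPreconnected (hsum.mul_left L) Metric.isOpen_ball
        (convex_ball (0 : ℝ) (|t| + 1)).isPreconnected
        (fun n s _ => hasDerivAt_dysonTerm hA n s) (fun n s h => ?_) htb
        ((summable_nat_add_iff 1).2 (hs t (by linarith))) htb
      have h' : |s| ≤ |t| + 1 := by simpa using (Metric.mem_ball.1 h).le
      exact (norm_mul_le _ _).trans
        (mul_le_mul (hL' s h') (hbound n s h') (norm_nonneg _) hL0)
    rw [(hs t (by linarith)).tsum_mul_left] at hder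
    refine (hder.const_add (1 : R)).congr_of_eventuallyEq ?_
    filter_upwards [Metric.isOpen_ball.mem_nhds htb] with s h
    have h' : |s| ≤ |t| + 1 := by simpa using (Metric.mem_ball.1 h).le
    exact (hs s h').tsum_eq_zero_add

end LinearODE

/-! ### Growth of the powers of a matrix with an eigenvalue outside the unit disc -/

section SpectralGrowth

open scoped ENNReal NNReal

/-- Gelfand's formula gives the bound with constant 1 for large `k`; the finitely many remaining
powers are absorbed in `C`. -/
lemma exists_norm_pow_le_of_spectralRadius_lt {𝒜 : Type*} [NormedRing 𝒜] [NormedAlgebra ℂ 𝒜]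
    [CompleteSpace 𝒜] (F : 𝒜) {b : ℝ} (hb : 0 < b)
    (hF : spectralRadius ℂ F < ENNReal.ofReal b) :
    ∃ C : ℝ, ∀ k, ‖F ^ k‖ ≤ C * b ^ k := by
  have h1 : ∀ᶠ k : ℕ in atTop, ‖F ^ k‖ ≤ b ^ k := by
    have := (spectrum.pow_norm_pow_one_div_tendsto_nhds_spectralRadius F).eventually
      (gt_mem_nhds hF)
    filter_upwards [this, eventually_gt_atTop 0] with k hk hk0
    have h2 := (ENNReal.ofReal_lt_ofReal_iff hb).1 hk
    have h3 : (‖F ^ k‖ ^ (1 / k : ℝ)) ^ k ≤ b ^ k := by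
      gcongr
    rwa [one_div, Real.rpow_inv_natCast_pow (norm_nonneg _) hk0.ne'] at h3
  obtain ⟨k₀, hk₀⟩ := eventually_atTop.1 h1
  refine ⟨1 + ∑ j ∈ Finset.range k₀, ‖F ^ j‖ / b ^ j, fun k => ?_⟩
  rw [add_mul, one_mul]
  have hnn : ∀ j, 0 ≤ ‖F ^ j‖ / b ^ j := fun j => by positivity
  rcases le_or_gt k₀ k with h | h
  · have : 0 ≤ (∑ j ∈ Finset.range k₀, ‖F ^ j‖ / b ^ j) * b ^ k :=
      mul_nonneg (Finset.sum_nonneg fun j _ => hnn j) (by positivity)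
    linarith [hk₀ k h]
  · have := Finset.single_le_sum (f := fun j => ‖F ^ j‖ / b ^ j) (fun j _ => hnn j)
      (Finset.mem_range.2 h)
    have h5 := mul_le_mul_of_nonneg_right this (pow_nonneg hb.le k)
    rw [div_mul_cancel₀ _ (by positivity)] at h5
    linarith [pow_pos hb k]

variable {E : Type*} [NormedAddCommGroup E] [NormedSpace ℝ E] [FiniteDimensional ℝ E]

/-- If `M` has an eigenvalue outside the closed unit disc, its spectral radius is the growth rate
of suitable real orbits. -/
lemma exists_growth_of_isRoot_charpoly (M : E →L[ℝ] E) {μ : ℂ} (hμ : 1 < ‖μ‖)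
    (hroot : (((M : E →ₗ[ℝ] E).charpoly).map (algebraMap ℝ ℂ)).IsRoot μ) :
    ∃ a b C c : ℝ, 1 < a ∧ 0 ≤ b ∧ b < a ^ 2 ∧ 0 < c ∧ (∀ k, ‖M ^ k‖ ≤ C * b ^ k) ∧
      ∀ n, ∃ v : E, (∀ k, ‖(M ^ k) v‖ ≤ C * a ^ k) ∧ c * a ^ n ≤ ‖(M ^ n) v‖ := by
  classical
  set e := Module.finBasis ℝ E
  set m := Module.finrank ℝ E
  set A : Matrix (Fin m) (Fin m) ℂ :=
    (LinearMap.toMatrix e e (M : E →ₗ[ℝ] E)).map (algebraMap ℝ ℂ) with hA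
  set F : (Fin m → ℂ) →L[ℂ] (Fin m → ℂ) := LinearMap.toContinuousLinearMap (Matrix.toLin' A)
    with hF
  have hspec : ∀ ν : ℂ, ν ∈ spectrum ℂ F ↔ ν ∈ spectrum ℂ A := fun ν => by
    rw [← Matrix.spectrum_toLin', ← AlgEquiv.spectrum_eq
      (Module.End.toContinuousLinearMap (𝕜 := ℂ) (Fin m → ℂ)) (Matrix.toLin' A)]
    rfl
  have hμF : μ ∈ spectrum ℂ F := by
    rw [hspec, Matrix.mem_spectrum_iff_isRoot_charpoly, hA, Matrix.charpoly_map, LinearMap.charpoly_toMatrix]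
    exact hroot
  obtain ⟨ν, hν, hνr⟩ := spectrum.exists_nnnorm_eq_spectralRadius_of_nonempty ⟨μ, hμF⟩
  have hμν : ‖μ‖ ≤ ‖ν‖ := by
    have : (‖μ‖₊ : ℝ≥0∞) ≤ ‖ν‖₊ := by
      rw [hνr]; exact le_iSup₂ (f := fun k (_ : k ∈ spectrum ℂ F) => (‖k‖₊ : ℝ≥0∞)) μ hμF
    exact_mod_cast this
  have ha : 1 < ‖ν‖ := hμ.trans_le hμν
  -- Jordan blocks may forbid the rate `‖ν‖` itself for `‖M ^ k‖`. Any rate below `‖ν‖ ^ 2` suffices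
  -- later, and there is room because `1 < ‖ν‖`.
  obtain ⟨b, hb1, hb2⟩ : ∃ b, ‖ν‖ < b ∧ b < ‖ν‖ ^ 2 := exists_between (by nlinarith)
  have hb0 : 0 < b := by linarith
  obtain ⟨C₀, hC₀⟩ := exists_norm_pow_le_of_spectralRadius_lt F hb0 (by
    rw [← hνr, ← ENNReal.ofReal_coe_nnreal, coe_nnnorm]
    exact (ENNReal.ofReal_lt_ofReal_iff hb0).2 hb1)
  -- the real-linear embedding of `E` into `ℂ ^ m`
  set J : E → Fin m → ℂ := fun x i => (e.repr x i : ℂ) with hJ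
  have hJM : ∀ x, J (M x) = F (J x) := fun x => by
    funext i
    have := congrFun (LinearMap.toMatrix_mulVec_repr e e (M : E →ₗ[ℝ] E) x) i
    simp only [hJ, hF, LinearMap.coe_toContinuousLinearMap', Matrix.toLin'_apply]
    simp only [ContinuousLinearMap.coe_coe] at this
    rw [← this]
    simp [Matrix.mulVec, dotProduct, hA]
  have hJMk : ∀ k x, J ((M ^ k) x) = (F ^ k) (J x) := fun k => by
    induction k with
    | zero => intro x; simp
    | succ k ih => intro x; rw [pow_succ, pow_succ]; exact (ih (M x)).trans (by rw [hJM]; rfl)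
  have hJn : ∀ x, ‖J x‖ = ‖e.equivFunL x‖ := fun x => by
    have : ∀ i, ‖J x i‖₊ = ‖e.equivFunL x i‖₊ := fun i => by
      simp only [hJ, Complex.nnnorm_real]
      rfl
    simp only [Pi.norm_def, this]
  set c₁ := ‖(e.equivFunL.symm : (Fin m → ℝ) →L[ℝ] E)‖ + 1 with hc₁
  set c₂ := ‖(e.equivFunL : E →L[ℝ] (Fin m → ℝ))‖ + 1 with hc₂
  have hc₁0 : 0 < c₁ := by positivity
  have hc₂0 : 0 < c₂ := by positivity
  have hle₁ : ∀ x, ‖x‖ ≤ c₁ * ‖J x‖ := fun x => by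
    rw [hJn]
    calc ‖x‖ = ‖e.equivFunL.symm (e.equivFunL x)‖ := by simp
      _ ≤ ‖(e.equivFunL.symm : (Fin m → ℝ) →L[ℝ] E)‖ * ‖e.equivFunL x‖ :=
        (e.equivFunL.symm : (Fin m → ℝ) →L[ℝ] E).le_opNorm _
      _ ≤ _ := by gcongr; linarith
  have hle₂ : ∀ x, ‖J x‖ ≤ c₂ * ‖x‖ := fun x => by
    rw [hJn]
    exact ((e.equivFunL : E →L[ℝ] (Fin m → ℝ)).le_opNorm x).trans (by gcongr; linarith)
  obtain ⟨v, hv⟩ := (Module.End.HasEigenvalue.of_mem_spectrum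
    (show ν ∈ spectrum ℂ (Matrix.toLin' A) by
      rwa [Matrix.spectrum_toLin', ← hspec])).exists_hasEigenvector
  have hFv : ∀ k : ℕ, (F ^ k) v = ν ^ k • v := fun k => by
    induction k with
    | zero => simp
    | succ k ih =>
      have : F v = ν • v := hv.apply_eq_smul
      rw [pow_succ]
      change (F ^ k) (F v) = _
      rw [this, map_smul, ih, smul_smul, pow_succ, mul_comm]
  -- Real and imaginary parts of an eigenvector for an eigenvalue of maximal modulus. Both orbits
  -- grow at most like `‖ν‖ ^ k`; which of them is large may depend on the time `n`.
  set x := e.equivFun.symm (fun i => (v i).re) with hx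
  set y := e.equivFun.symm (fun i => (v i).im) with hy
  have hJx : ∀ i, J x i = (v i).re := fun i => by
    change ((e.equivFun x i : ℝ) : ℂ) = _
    rw [hx, LinearEquiv.apply_symm_apply]
  have hJy : ∀ i, J y i = (v i).im := fun i => by
    change ((e.equivFun y i : ℝ) : ℂ) = _
    rw [hy, LinearEquiv.apply_symm_apply]
  have hvxy : v = J x + Complex.I • J y := by
    funext i
    rw [Pi.add_apply, Pi.smul_apply, hJx, hJy, smul_eq_mul, mul_comm, Complex.re_add_im]
  have hsplit : ∀ k : ℕ, ν ^ k • v = J ((M ^ k) x) + Complex.I • J ((M ^ k) y) := fun k => by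
    rw [hJMk, hJMk, ← hFv, ← map_smul, ← map_add, ← hvxy]
  have hkx : ∀ k, ‖J ((M ^ k) x)‖ ≤ ‖ν‖ ^ k * ‖v‖ := fun k => by
    rw [← norm_pow, ← norm_smul]
    refine (pi_norm_le_iff_of_nonneg (norm_nonneg _)).2 fun i => ?_
    refine le_trans ?_ (norm_le_pi_norm _ i)
    rw [hsplit]
    simp only [hJ, Pi.add_apply, Pi.smul_apply, smul_eq_mul, Complex.norm_real]
    refine le_trans (le_of_eq ?_) (Complex.abs_re_le_norm _)
    simp
  have hky : ∀ k, ‖J ((M ^ k) y)‖ ≤ ‖ν‖ ^ k * ‖v‖ := fun k => by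
    rw [← norm_pow, ← norm_smul]
    refine (pi_norm_le_iff_of_nonneg (norm_nonneg _)).2 fun i => ?_
    refine le_trans ?_ (norm_le_pi_norm _ i)
    rw [hsplit]
    simp only [hJ, Pi.add_apply, Pi.smul_apply, smul_eq_mul, Complex.norm_real]
    refine le_trans (le_of_eq ?_) (Complex.abs_im_le_norm _)
    simp
  have hv0 : 0 < ‖v‖ := norm_pos_iff.2 hv.2
  set C := max (c₁ * c₂ * C₀) (c₁ * ‖v‖) with hC
  have hup : ∀ w, (∀ k, ‖J ((M ^ k) w)‖ ≤ ‖ν‖ ^ k * ‖v‖) →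
      ∀ k, ‖(M ^ k) w‖ ≤ C * ‖ν‖ ^ k := fun w hw k =>
    calc ‖(M ^ k) w‖ ≤ c₁ * (‖ν‖ ^ k * ‖v‖) :=
          (hle₁ _).trans (mul_le_mul_of_nonneg_left (hw k) hc₁0.le)
      _ = (c₁ * ‖v‖) * ‖ν‖ ^ k := by ring
      _ ≤ _ := by gcongr; exact le_max_right _ _
  have hlow : ∀ n w, ‖ν‖ ^ n * ‖v‖ / 2 ≤ ‖J ((M ^ n) w)‖ →
      ‖v‖ / (2 * c₂) * ‖ν‖ ^ n ≤ ‖(M ^ n) w‖ := fun n w hw => by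
    have := hw.trans (hle₂ _)
    rw [div_mul_eq_mul_div, div_le_iff₀ (by positivity)]
    linarith
  refine ⟨‖ν‖, b, C, ‖v‖ / (2 * c₂), ha, hb0.le, hb2, by positivity, fun k => ?_, fun n => ?_⟩
  · have h0 : 0 ≤ C := le_max_of_le_right (by positivity)
    refine ContinuousLinearMap.opNorm_le_bound _ (by positivity) fun w => ?_
    calc ‖(M ^ k) w‖ ≤ c₁ * ‖(F ^ k) (J w)‖ := by rw [← hJMk]; exact hle₁ _
      _ ≤ c₁ * ((C₀ * b ^ k) * (c₂ * ‖w‖)) := by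
        gcongr
        exact (ContinuousLinearMap.le_opNorm _ _).trans
          (mul_le_mul (hC₀ k) (hle₂ w) (norm_nonneg _) ((norm_nonneg _).trans (hC₀ k)))
      _ = (c₁ * c₂ * C₀) * b ^ k * ‖w‖ := by ring
      _ ≤ _ := by gcongr; exact le_max_left _ _
  -- The two parts add up to `ν ^ n • v`, so one of them carries at least half of its norm.
  · have h := norm_add_le (J ((M ^ n) x)) (Complex.I • J ((M ^ n) y))
    rw [← hsplit, norm_smul, norm_smul, norm_pow, Complex.norm_I, one_mul] at h
    rcases le_or_gt (‖ν‖ ^ n * ‖v‖ / 2) ‖J ((M ^ n) x)‖ with h1 | h1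
    · exact ⟨x, hup x hkx, hlow n x h1⟩
    · exact ⟨y, hup y hky, hlow n y (by linarith)⟩

end SpectralGrowth

/-! ### Instability of quadratic perturbations of a linear map -/

section DiscreteInstability

variable {E : Type*} [NormedAddCommGroup E] [NormedSpace ℝ E]

/-- Discrete variation of constants: each one-step error is transported by the remaining linear
steps. -/
lemma perturbed_iterate_eq (M : E →L[ℝ] E) (x : ℕ → E) (n : ℕ) :
    x n - (M ^ n) (x 0) =
      ∑ k ∈ Finset.range n, (M ^ (n - 1 - k)) (x (k + 1) - M (x k)) := by
  induction n with
  | zero => simp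
  | succ n ih =>
    rw [Finset.sum_range_succ]
    have : ∑ k ∈ Finset.range n, (M ^ (n + 1 - 1 - k)) (x (k + 1) - M (x k)) =
        M (∑ k ∈ Finset.range n, (M ^ (n - 1 - k)) (x (k + 1) - M (x k))) := by
      rw [map_sum]
      refine Finset.sum_congr rfl fun k hk => ?_
      have hk' := Finset.mem_range.1 hk
      rw [show n + 1 - 1 - k = (n - 1 - k) + 1 by omega, pow_succ']
      rfl
    rw [this, ← ih, pow_succ']
    simp

/-- The sum times `a - b` is `a ^ n - b ^ n`. It is used with `a ^ 2` in place of `a`, the rate of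
the quadratic errors. -/
lemma sum_geometric_le {a b : ℝ} (hb : 0 ≤ b) (hab : b < a) (n : ℕ) :
    ∑ k ∈ Finset.range n, b ^ (n - 1 - k) * a ^ k ≤ a ^ n / (a - b) := by
  have h := Commute.geom_sum₂_mul (Commute.all a b) n
  rw [le_div_iff₀ (by linarith)]
  have : ∑ k ∈ Finset.range n, b ^ (n - 1 - k) * a ^ k =
      ∑ k ∈ Finset.range n, a ^ k * b ^ (n - 1 - k) :=
    Finset.sum_congr rfl fun _ _ => mul_comm _ _
  rw [this, h]
  linarith [pow_nonneg hb n]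

/-- A quadratic perturbation of a linear map whose orbits of maximal growth `a ^ n`, `1 < a`, are
controlled is unstable. -/
lemma exists_escape_of_growth (M : E →L[ℝ] E) {a b C c : ℝ} (ha : 1 < a) (hb : 0 ≤ b)
    (hab : b < a ^ 2) (hc : 0 < c) (hM : ∀ k, ‖M ^ k‖ ≤ C * b ^ k)
    (hv : ∀ n, ∃ v : E, (∀ k, ‖(M ^ k) v‖ ≤ C * a ^ k) ∧ c * a ^ n ≤ ‖(M ^ n) v‖)
    {C₁ : ℝ} (hC₁ : 0 ≤ C₁) :
    ∃ η > 0, ∀ δ > 0, ∃ x₀ : E, ‖x₀‖ < δ ∧ ∀ x : ℕ → E, x 0 = x₀ →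
      (∀ k, ‖x (k + 1) - M (x k)‖ ≤ C₁ * ‖x k‖ ^ 2) → ∃ n, η ≤ ‖x n‖ := by
  have hC : 0 < C := by
    obtain ⟨v, h1, h2⟩ := hv 0
    have := (h2.trans (h1 0))
    simp at this
    linarith
  set G := a ^ 2 - b with hG
  have hG0 : 0 < G := by linarith
  set D := C * C₁ * (2 * C) ^ 2 / G with hD
  have hD0 : 0 ≤ D := by positivity
  -- `σ` is the scale reached by the linear orbit at the final time. The first inequality closes the
  -- induction `‖x j‖ ≤ 2C s a ^ j`; the second keeps the final error below half of the linear
  -- growth, whence the escape radius `c * σ / 2`.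
  obtain ⟨σ, hσ0, hσ1, hσ2⟩ : ∃ σ > 0, D * σ ≤ C ∧ D * σ ≤ c / 2 := by
    refine ⟨min C (c / 2) / (D + 1), by positivity, ?_, ?_⟩
    · rw [mul_div_assoc', div_le_iff₀ (by positivity)]
      nlinarith [min_le_left C (c / 2)]
    · rw [mul_div_assoc', div_le_iff₀ (by positivity)]
      nlinarith [min_le_right C (c / 2)]
  refine ⟨c * σ / 2, by positivity, fun δ hδ => ?_⟩
  have ha0 : 0 < a := by linarith
  -- The smaller `δ`, the longer the orbit runs: starting at size about `σ / a ^ n`, it reaches the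
  -- scale `σ`, independent of `δ`, at time `n`.
  obtain ⟨n, hn⟩ : ∃ n : ℕ, σ * C / δ < a ^ n := pow_unbounded_of_one_lt _ ha
  obtain ⟨v, hv1, hv2⟩ := hv n
  have han : 0 < a ^ n := by positivity
  set s := σ / a ^ n with hs
  have hs0 : 0 < s := by positivity
  have hsa : ∀ k ≤ n, s * a ^ k ≤ σ := fun k hk => by
    rw [hs, div_mul_eq_mul_div, div_le_iff₀ han]
    gcongr
    exact ha.le
  refine ⟨s • v, ?_, fun x hx0 hx => ⟨n, ?_⟩⟩
  · rw [norm_smul, Real.norm_of_nonneg hs0.le]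
    have := hv1 0
    simp only [pow_zero, mul_one, one_apply_eq_self] at this
    calc s * ‖v‖ ≤ s * C := by gcongr
      _ < δ := by
        rw [hs, div_mul_eq_mul_div, div_lt_iff₀ han]
        rw [div_lt_iff₀ hδ] at hn
        linarith
  · have key : ∀ k ≤ n, ‖x k - (M ^ k) (x 0)‖ ≤ D * (s * a ^ k) ^ 2 := by
      intro k
      induction k using Nat.strong_induction_on with
      | _ k ih =>
        intro hk
        have hxj : ∀ j < k, ‖x j‖ ≤ 2 * C * (s * a ^ j) := fun j hj => by
          have h1 := ih j hj (hj.le.trans hk)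
          have h2 : ‖(M ^ j) (x 0)‖ ≤ C * (s * a ^ j) := by
            rw [hx0, map_smul, norm_smul, Real.norm_of_nonneg hs0.le]
            nlinarith [hv1 j]
          have h3 : D * (s * a ^ j) ^ 2 ≤ C * (s * a ^ j) := by
            have := hsa j (hj.le.trans hk)
            rw [pow_two, ← mul_assoc]
            gcongr
            exact (mul_le_mul_of_nonneg_left this hD0).trans hσ1
          have := norm_le_norm_sub_add (x j) ((M ^ j) (x 0))
          linarith
        rw [perturbed_iterate_eq]
        calc _ ≤ ∑ j ∈ Finset.range k, ‖(M ^ (k - 1 - j)) (x (j + 1) - M (x j))‖ :=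
              norm_sum_le _ _
          _ ≤ ∑ j ∈ Finset.range k,
              (C * C₁ * (2 * C) ^ 2 * s ^ 2) * (b ^ (k - 1 - j) * (a ^ 2) ^ j) := by
              refine Finset.sum_le_sum fun j hj => ?_
              have hj' := Finset.mem_range.1 hj
              calc _ ≤ ‖M ^ (k - 1 - j)‖ * ‖x (j + 1) - M (x j)‖ :=
                    ContinuousLinearMap.le_opNorm _ _
                _ ≤ (C * b ^ (k - 1 - j)) * (C₁ * (2 * C * (s * a ^ j)) ^ 2) := by
                    refine mul_le_mul (hM _) ((hx j).trans ?_) (norm_nonneg _) (by positivity)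
                    gcongr
                    exact hxj j hj'
                _ = _ := by ring
          _ ≤ (C * C₁ * (2 * C) ^ 2 * s ^ 2) * ((a ^ 2) ^ k / G) := by
              rw [← Finset.mul_sum]
              gcongr
              exact sum_geometric_le hb hab k
          _ = _ := by rw [hD]; ring
    have h1 := key n le_rfl
    have h2 : c * σ ≤ ‖(M ^ n) (x 0)‖ := by
      rw [hx0, map_smul, norm_smul, Real.norm_of_nonneg hs0.le]
      calc c * σ = s * (c * a ^ n) := by rw [hs]; field_simp
        _ ≤ _ := by gcongr
    have h3 : s * a ^ n = σ := by rw [hs]; field_simp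
    rw [h3] at h1
    have h4 : D * σ ^ 2 ≤ c * σ / 2 := by nlinarith
    have := norm_le_norm_sub_add ((M ^ n) (x 0)) (x n)
    rw [norm_sub_rev] at this
    linarith

end DiscreteInstability

/-! ### From the period map to solutions of the differential equation -/

section LinearizedInstability

variable {E : Type*} [NormedAddCommGroup E] [NormedSpace ℝ E]

/-- Over one period, a solution of a quadratic perturbation of a linear equation follows the linear
flow up to a quadratic error. -/
lemma norm_sub_linear_flow_le {A : ℝ → E →L[ℝ] E} {Ψ : ℝ → E →L[ℝ] E} {e e' : ℝ → E}
    {τ T L C : ℝ} (hT : 0 < T) (hL : 0 < L) (hC : 0 ≤ C)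
    (hΨτ : Ψ τ = ContinuousLinearMap.id ℝ E) (hΨ : ∀ t, HasDerivAt Ψ ((A t).comp (Ψ t)) t)
    (hAL : ∀ t, ‖A t‖ ≤ L) (hec : ContinuousOn e (Icc τ (τ + T)))
    (he : ∀ t ∈ Ico τ (τ + T), HasDerivWithinAt e (e' t) (Ici t) t)
    (h1 : ∀ t ∈ Ico τ (τ + T), ‖e' t‖ ≤ L * ‖e t‖)
    (h2 : ∀ t ∈ Ico τ (τ + T), ‖e' t - A t (e t)‖ ≤ C * ‖e t‖ ^ 2) :
    ‖e (τ + T) - Ψ (τ + T) (e τ)‖ ≤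
      C * Real.exp (L * T) ^ 2 / L * (Real.exp (L * T) - 1) * ‖e τ‖ ^ 2 := by
  have hT' : τ + T ∈ Icc τ (τ + T) := ⟨by linarith, le_rfl⟩
  have hgr : ∀ t ∈ Icc τ (τ + T), ‖e t‖ ≤ ‖e τ‖ * Real.exp (L * T) := fun t ht => by
    have := norm_le_gronwallBound_of_norm_deriv_right_le (K := L) (ε := 0) hec he le_rfl
      (fun s hs => by simpa using h1 s hs) t ht
    rw [gronwallBound_ε0] at this
    refine this.trans ?_
    gcongr
    linarith [ht.2]
  have hΨc : Continuous Ψ := continuous_iff_continuousAt.2 fun t => (hΨ t).continuousAt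
  have hy : ∀ t ∈ Ico τ (τ + T), HasDerivWithinAt (fun s => e s - Ψ s (e τ))
      (e' t - A t (Ψ t (e τ))) (Ici t) t := fun t ht => by
    have := ((hΨ t).clm_apply (hasDerivAt_const t (e τ))).hasDerivWithinAt (s := Ici t)
    simpa [Pi.sub_def] using (he t ht).sub this
  have := norm_le_gronwallBound_of_norm_deriv_right_le (δ := 0) (K := L)
    (ε := C * (‖e τ‖ * Real.exp (L * T)) ^ 2)
    (f := fun s => e s - Ψ s (e τ)) (hec.sub (hΨc.clm_apply continuous_const).continuousOn) hy (by simp [hΨτ])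
    (fun t ht => ?_) _ hT'
  · rw [gronwallBound_of_K_ne_0 hL.ne'] at this
    refine this.trans (le_of_eq ?_)
    rw [add_sub_cancel_left]
    ring
  · have h3 : e' t - A t (Ψ t (e τ)) = A t (e t - Ψ t (e τ)) + (e' t - A t (e t)) := by
      rw [map_sub]; abel
    rw [h3]
    refine (norm_add_le _ _).trans (add_le_add ?_ ((h2 t ht).trans ?_))
    · exact (ContinuousLinearMap.le_opNorm _ _).trans (by gcongr; exact hAL t)
    · gcongr
      exact hgr t (Ico_subset_Icc_self ht)

/-- Instability by linearization along a solution whose variational equation is periodic. -/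
lemma exists_escape_of_multiplier [FiniteDimensional ℝ E] {X : ℝ → E → E} {z : ℝ → E}
    {A Φ : ℝ → E →L[ℝ] E} {T L C η₀ : ℝ} (hT : 0 < T) (hL : 0 < L) (hC : 0 ≤ C) (hη₀ : 0 < η₀)
    (hA : ∀ t, A (t + T) = A t) (hAL : ∀ t, ‖A t‖ ≤ L)
    (hΦ0 : Φ 0 = ContinuousLinearMap.id ℝ E) (hΦ : ∀ t, HasDerivAt Φ ((A t).comp (Φ t)) t)
    (hz : ∀ t, HasDerivAt z (X t (z t)) t)
    (h1 : ∀ t y, ‖y - z t‖ ≤ η₀ → ‖X t y - X t (z t)‖ ≤ L * ‖y - z t‖)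
    (h2 : ∀ t y, ‖y - z t‖ ≤ η₀ → ‖X t y - X t (z t) - A t (y - z t)‖ ≤ C * ‖y - z t‖ ^ 2)
    {μ : ℂ} (hμ : 1 < ‖μ‖)
    (hroot : (((Φ T : E →ₗ[ℝ] E).charpoly).map (algebraMap ℝ ℂ)).IsRoot μ) :
    ∃ η > 0, ∀ δ > 0, ∃ w₀, ‖w₀ - z 0‖ < δ ∧ ∀ w : ℝ → E, w 0 = w₀ →
      (∀ t, 0 ≤ t → HasDerivWithinAt w (X t (w t)) (Ici 0) t) →
      ∃ t, 0 ≤ t ∧ η ≤ ‖w t - z t‖ := by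
  obtain ⟨a, b, C', c, ha, hb, hab, hc, hM, hv⟩ := exists_growth_of_isRoot_charpoly _ hμ hroot
  have hG : 0 ≤ Real.exp (L * T) - 1 := by
    linarith [Real.add_one_le_exp (L * T), mul_pos hL hT]
  obtain ⟨η, hη, hesc⟩ := exists_escape_of_growth (Φ T) ha hb hab hc hM hv
    (C₁ := C * Real.exp (L * T) ^ 2 / L * (Real.exp (L * T) - 1)) (by positivity)
  refine ⟨min η η₀, lt_min hη hη₀, fun δ hδ => ?_⟩
  obtain ⟨x₀, hx₀, hx⟩ := hesc δ hδ
  refine ⟨z 0 + x₀, by simpa using hx₀, fun w hw0 hw => ?_⟩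
  -- A solution that never escapes stays in the tube, so the quadratic error estimate holds over
  -- every period and the discrete lemma forces an escape.
  by_contra! hcon
  have hAk : ∀ (k : ℕ) t, A (t + k * T) = A t := fun k => by
    induction k with
    | zero => simp
    | succ k ih =>
      intro t
      rw [← ih t, ← hA (t + k * T)]
      congr 1
      push_cast
      ring
  have hle : ∀ t, 0 ≤ t → ‖w t - z t‖ ≤ η₀ := fun t ht =>
    (hcon t ht).le.trans (min_le_right _ _)
  obtain ⟨n, hn⟩ := hx (fun k : ℕ => w (k * T) - z (k * T)) (by simp [hw0]) (fun k => by
    have hk0 : 0 ≤ (k : ℝ) * T := by positivity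
    have hwz : ∀ t, 0 ≤ t → HasDerivWithinAt (fun s => w s - z s)
        (X t (w t) - X t (z t)) (Ici 0) t := fun t ht =>
      (hw t ht).sub (hz t).hasDerivWithinAt
    -- By periodicity of `A` the shifted `Φ` is the fundamental solution based at `k * T`, so the
    -- same matrix `Φ T` governs every period.
    have := norm_sub_linear_flow_le (A := A) (Ψ := fun t => Φ (t - k * T))
      (e := fun s => w s - z s) (τ := k * T) hT hL hC (by simpa using hΦ0)
      (fun t => by
        have h := (hΦ (t - k * T)).comp_sub_const t (k * T)
        rwa [← hAk k (t - k * T), sub_add_cancel] at h) hAL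
      (fun t ht => ((hwz t (hk0.trans ht.1)).continuousWithinAt).mono
        fun s hs => hk0.trans hs.1)
      (fun t ht => (hwz t (hk0.trans ht.1)).mono fun s hs => (hk0.trans ht.1).trans hs)
      (fun t ht => h1 t _ (hle t (hk0.trans ht.1)))
      (fun t ht => h2 t _ (hle t (hk0.trans ht.1)))
    rw [add_sub_cancel_left] at this
    push_cast
    rwa [add_mul, one_mul])
  exact absurd (hcon (n * T) (by positivity)) (not_lt.2 ((min_le_left _ _).trans hn))

end LinearizedInstability

/-! ### Monodromy of a perturbed nilpotent equation, to first order -/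

section MonodromyAsymptotics

variable {E : Type*} [NormedAddCommGroup E] [NormedSpace ℝ E]

/-- Linear equations `Φ' = (g(ε, t) 𝒩 + ε B(ε, t)) Φ`, where `𝒩 = e ⊗ ρ` is nilpotent and the
coefficients converge uniformly on `[0, T]` as `ε → 0⁺`. -/
structure NilpotentPerturbation (e : E) (ρ : E →L[ℝ] ℝ) (T α : ℝ) (g : ℝ → ℝ → ℝ)
    (B₀ : ℝ → E →L[ℝ] E) (B Φ : ℝ → ℝ → E →L[ℝ] E) : Prop where
  nilpotent : ρ e = 0
  period_nonneg : 0 ≤ T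
  continuous_limit : Continuous B₀
  tendsto_coeff : ∀ η > 0, ∀ᶠ ε in 𝓝[>] (0 : ℝ), ∀ t ∈ Icc 0 T, |g ε t - α| ≤ η
  tendsto_perturbation : ∀ η > 0, ∀ᶠ ε in 𝓝[>] (0 : ℝ), ∀ t ∈ Icc 0 T, ‖B ε t - B₀ t‖ ≤ η
  initial : ∀ᶠ ε in 𝓝[>] (0 : ℝ), Φ ε 0 = ContinuousLinearMap.id ℝ E
  hasDerivAt : ∀ᶠ ε in 𝓝[>] (0 : ℝ), ∀ t,
    HasDerivAt (Φ ε) ((g ε t • ρ.smulRight e + ε • B ε t).comp (Φ ε t)) t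

namespace NilpotentPerturbation

variable {e : E} {ρ : E →L[ℝ] ℝ} {T α : ℝ} {g : ℝ → ℝ → ℝ} {B₀ : ℝ → E →L[ℝ] E}
  {B Φ : ℝ → ℝ → E →L[ℝ] E}

lemma exists_bound (H : NilpotentPerturbation e ρ T α g B₀ B Φ) :
    ∃ b, 0 ≤ b ∧ (∀ t ∈ Icc 0 T, ‖B₀ t‖ ≤ b) ∧
      ∀ᶠ ε in 𝓝[>] (0 : ℝ), ∀ t ∈ Icc 0 T, ‖B ε t‖ ≤ b := by
  obtain ⟨b, hb⟩ := isCompact_Icc.exists_bound_of_continuousOn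
    (s := Icc 0 T) H.continuous_limit.continuousOn
  have h0 : 0 ≤ b := (norm_nonneg _).trans (hb 0 ⟨le_rfl, H.period_nonneg⟩)
  refine ⟨b + 1, by linarith, fun t ht => (hb t ht).trans (by linarith), ?_⟩
  filter_upwards [H.tendsto_perturbation 1 one_pos] with ε h t ht
  have := norm_le_norm_sub_add (B ε t) (B₀ t)
  linarith [h t ht, hb t ht]

lemma eventually_norm_coeff_sub_le (H : NilpotentPerturbation e ρ T α g B₀ B Φ) {κ : ℝ}
    (hκ : 0 < κ) : ∀ᶠ ε in 𝓝[>] (0 : ℝ), ∀ t ∈ Icc 0 T,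
      ‖(g ε t • ρ.smulRight e + ε • B ε t) - α • ρ.smulRight e‖ ≤ κ := by
  obtain ⟨b, hb0, -, hb⟩ := H.exists_bound
  set n := ‖ρ.smulRight e‖
  have hsmall : ∀ᶠ ε in 𝓝[>] (0 : ℝ), ε < κ / 2 / (b + 1) :=
    nhdsWithin_le_nhds (gt_mem_nhds (by positivity))
  filter_upwards [hb, H.tendsto_coeff (κ / 2 / (n + 1)) (by positivity), hsmall,
    self_mem_nhdsWithin] with ε h1 h2 h3 h4 t ht
  have hε : 0 < ε := h4
  have : (g ε t • ρ.smulRight e + ε • B ε t) - α • ρ.smulRight e =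
      (g ε t - α) • ρ.smulRight e + ε • B ε t := by rw [sub_smul]; abel
  rw [this]
  refine (norm_add_le _ _).trans ?_
  rw [norm_smul, norm_smul, Real.norm_of_nonneg hε.le, Real.norm_eq_abs]
  have h5 : |g ε t - α| * n ≤ κ / 2 := by
    have := h2 t ht
    rw [le_div_iff₀ (by positivity)] at this
    nlinarith [abs_nonneg (g ε t - α)]
  have h6 : ε * ‖B ε t‖ ≤ κ / 2 := by
    have h7 := h3.le
    rw [le_div_iff₀ (by positivity)] at h7
    nlinarith [h1 t ht, norm_nonneg (B ε t)]
  linarith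

lemma exists_coeff_bound (H : NilpotentPerturbation e ρ T α g B₀ B Φ) :
    ∃ K, 0 ≤ K ∧ ∀ᶠ ε in 𝓝[>] (0 : ℝ), ∀ t ∈ Icc 0 T,
      ‖g ε t • ρ.smulRight e + ε • B ε t‖ ≤ K := by
  refine ⟨1 + ‖α • ρ.smulRight e‖, by positivity, ?_⟩
  filter_upwards [H.eventually_norm_coeff_sub_le one_pos] with ε h t ht
  exact (norm_le_norm_sub_add _ (α • ρ.smulRight e)).trans (by linarith [h t ht])

lemma exists_gronwallBound_le (K T : ℝ) {η : ℝ} (hη : 0 < η) :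
    ∃ κ > 0, gronwallBound 0 K κ T ≤ η := by
  have h : Tendsto (fun κ => gronwallBound 0 K κ T) (𝓝[>] 0) (𝓝 0) := by
    have := (gronwallBound_continuous_ε 0 K T).tendsto 0
    rw [gronwallBound_ε0_δ0] at this
    exact this.mono_left nhdsWithin_le_nhds
  obtain ⟨κ, h1, h2⟩ := ((h.eventually (gt_mem_nhds hη)).and self_mem_nhdsWithin).exists
  exact ⟨κ, h2, h1.le⟩

/-- The unperturbed flow is `1 + t α 𝒩`. -/
lemma eventually_norm_flow_sub_le (H : NilpotentPerturbation e ρ T α g B₀ B Φ) {η : ℝ}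
    (hη : 0 < η) : ∀ᶠ ε in 𝓝[>] (0 : ℝ), ∀ t ∈ Icc 0 T,
      ‖Φ ε t - (ContinuousLinearMap.id ℝ E + (t * α) • ρ.smulRight e)‖ ≤ η := by
  set Φ₀ : ℝ → E →L[ℝ] E := fun t => ContinuousLinearMap.id ℝ E + (t * α) • ρ.smulRight e
    with hΦ₀
  have hΦ₀c : Continuous Φ₀ := by fun_prop
  obtain ⟨c, hc⟩ := isCompact_Icc.exists_bound_of_continuousOn (s := Icc 0 T) hΦ₀c.continuousOn
  have hc0 : 0 ≤ c := (norm_nonneg _).trans (hc 0 ⟨le_rfl, H.period_nonneg⟩)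
  obtain ⟨K, hK0, hK⟩ := H.exists_coeff_bound
  obtain ⟨κ, hκ, hκη⟩ := exists_gronwallBound_le K T hη
  have hΦ₀d : ∀ t, HasDerivAt Φ₀ ((α • ρ.smulRight e).comp (Φ₀ t)) t := fun t => by
    -- The square of `ρ.smulRight e` vanishes because `ρ e = 0`, so the exponential series stops at
    -- first order.
    have h1 : (α • ρ.smulRight e).comp (Φ₀ t) = (1 * α) • ρ.smulRight e := by
      ext x
      simp [hΦ₀, H.nilpotent]
    rw [h1]
    exact (((hasDerivAt_id t).mul_const α).smul_const (ρ.smulRight e)).const_add _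
  filter_upwards [hK, H.eventually_norm_coeff_sub_le (κ := κ / (c + 1)) (by positivity),
    H.initial, H.hasDerivAt] with ε hKε hκε hi hd t ht
  set A := fun t => g ε t • ρ.smulRight e + ε • B ε t
  have hy : ∀ s, HasDerivAt (fun s => Φ ε s - Φ₀ s)
      ((A s).comp (Φ ε s) - (α • ρ.smulRight e).comp (Φ₀ s)) s := fun s =>
    (hd s).sub (hΦ₀d s)
  have := norm_le_gronwallBound_of_norm_deriv_right_le (δ := 0) (K := K) (ε := κ)
    (f := fun s => Φ ε s - Φ₀ s) (a := 0) (b := T)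
    (fun s _ => (hy s).continuousAt.continuousWithinAt)
    (fun s _ => (hy s).hasDerivWithinAt) (by simp [hi, hΦ₀]) (fun s hs => ?_) t ht
  · refine this.trans ((gronwallBound_mono le_rfl hκ.le hK0 ?_).trans hκη)
    linarith [ht.2]
  · have hs' := Ico_subset_Icc_self hs
    have h2 : (A s).comp (Φ ε s) - (α • ρ.smulRight e).comp (Φ₀ s) =
        (A s).comp (Φ ε s - Φ₀ s) + (A s - α • ρ.smulRight e).comp (Φ₀ s) := by
      rw [ContinuousLinearMap.comp_sub, ContinuousLinearMap.sub_comp]; abel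
    rw [h2]
    refine (norm_add_le _ _).trans (add_le_add ?_ ?_)
    · exact (ContinuousLinearMap.opNorm_comp_le _ _).trans (by gcongr; exact hKε s hs')
    · calc _ ≤ ‖A s - α • ρ.smulRight e‖ * ‖Φ₀ s‖ := ContinuousLinearMap.opNorm_comp_le _ _
        _ ≤ κ / (c + 1) * (c + 1) := by
          gcongr
          · exact hκε s hs'
          · linarith [hc s hs']
        _ = κ := by field_simp

lemma tendsto_monodromy (H : NilpotentPerturbation e ρ T α g B₀ B Φ) (x : E) :
    Tendsto (fun ε => Φ ε T x) (𝓝[>] 0) (𝓝 (x + (T * α * ρ x) • e)) := by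
  rw [Metric.tendsto_nhds]
  intro η hη
  filter_upwards [H.eventually_norm_flow_sub_le (η := η / 2 / (‖x‖ + 1)) (by positivity)]
    with ε h
  have h1 := h T ⟨H.period_nonneg, le_rfl⟩
  have h2 : Φ ε T x - (x + (T * α * ρ x) • e) =
      (Φ ε T - (ContinuousLinearMap.id ℝ E + (T * α) • ρ.smulRight e)) x := by
    simp [smul_smul]
  rw [dist_eq_norm, h2]
  refine (ContinuousLinearMap.le_opNorm _ _).trans_lt ?_
  calc _ ≤ η / 2 / (‖x‖ + 1) * (‖x‖ + 1) := by gcongr; linarith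
    _ = η / 2 := by field_simp
    _ < η := by linarith

/-- On the kernel of the unperturbed coefficient the monodromy is the identity up to `O(ε)`. -/
lemma exists_norm_monodromy_sub_le (H : NilpotentPerturbation e ρ T α g B₀ B Φ) {x : E}
    (hx : ρ x = 0) : ∃ C, ∀ᶠ ε in 𝓝[>] (0 : ℝ), ‖Φ ε T x - x‖ ≤ C * ε := by
  obtain ⟨b, hb0, -, hb⟩ := H.exists_bound
  obtain ⟨K, hK0, hK⟩ := H.exists_coeff_bound
  refine ⟨b * ‖x‖ / (K + 1) * (Real.exp ((K + 1) * T) - 1), ?_⟩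
  filter_upwards [hK, hb, H.initial, H.hasDerivAt, self_mem_nhdsWithin] with ε hKε hbε hi hd hε
  have hε0 : (0 : ℝ) < ε := hε
  have hy : ∀ s, HasDerivAt (fun s => Φ ε s x - x)
      ((g ε s • ρ.smulRight e + ε • B ε s) (Φ ε s x)) s := fun s => by
    simpa using ((hd s).clm_apply (hasDerivAt_const s x)).sub_const x
  -- `K + 1` instead of `K` keeps the rate nonzero in the closed formula for the Gronwall bound.
  have := norm_le_gronwallBound_of_norm_deriv_right_le (δ := 0) (K := K + 1)
    (ε := ε * (b * ‖x‖))
    (f := fun s => Φ ε s x - x) (a := 0) (b := T)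
    (fun s _ => (hy s).continuousAt.continuousWithinAt)
    (fun s _ => (hy s).hasDerivWithinAt) (by simp [hi]) (fun s hs => ?_) T
    ⟨H.period_nonneg, le_rfl⟩
  · rw [gronwallBound_of_K_ne_0 (by positivity)] at this
    refine this.trans (le_of_eq ?_)
    rw [sub_zero]
    ring
  · have hs' := Ico_subset_Icc_self hs
    -- Since `ρ x = 0`, the coefficient of order one does not act on `x`, and the forcing of the
    -- difference is only `ε B x`.
    have h2 : (g ε s • ρ.smulRight e + ε • B ε s) (Φ ε s x) =
        (g ε s • ρ.smulRight e + ε • B ε s) (Φ ε s x - x) + ε • B ε s x := by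
      rw [map_sub]
      simp [hx]
    rw [h2]
    refine (norm_add_le _ _).trans (add_le_add ?_ ?_)
    · exact (ContinuousLinearMap.le_opNorm _ _).trans
        (by gcongr; exact (hKε s hs').trans (by linarith))
    · rw [norm_smul, Real.norm_of_nonneg hε0.le]
      gcongr
      exact (ContinuousLinearMap.le_opNorm _ _).trans (by gcongr; exact hbε s hs')

/-- First order expansion of the monodromy modulo the range of the unperturbed coefficient. -/
lemma tendsto_inv_smul_monodromy (H : NilpotentPerturbation e ρ T α g B₀ B Φ) {ℓ : E →L[ℝ] ℝ}
    (hℓ : ℓ e = 0) (x : E) :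
    Tendsto (fun ε => ε⁻¹ * ℓ (Φ ε T x - x)) (𝓝[>] 0)
      (𝓝 (∫ t in (0 : ℝ)..T, ℓ (B₀ t (x + (t * α * ρ x) • e)))) := by
  rw [Metric.tendsto_nhds]
  intro η hη
  obtain ⟨b, hb0, hb₀, hb⟩ := H.exists_bound
  have hT := H.period_nonneg
  have hφc : Continuous fun t : ℝ => ContinuousLinearMap.id ℝ E + (t * α) • ρ.smulRight e := by
    fun_prop
  obtain ⟨c, hc⟩ := isCompact_Icc.exists_bound_of_continuousOn (s := Icc 0 T) hφc.continuousOn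
  have hc0 : 0 ≤ c := (norm_nonneg _).trans (hc 0 ⟨le_rfl, hT⟩)
  -- Shared tolerance: the flow error is multiplied by `b`, the coefficient error by `c`, both by
  -- `‖x‖` and `‖ℓ‖`, and the sum is integrated over a length `T`.
  set κ := η / 2 / (T + 1) / (‖ℓ‖ + 1) / (‖x‖ + 1) / (b + c + 1) with hκ
  have hκ0 : 0 < κ := by positivity
  set f := fun t => ℓ (B₀ t (x + (t * α * ρ x) • e)) with hf
  have hfc : Continuous f := by
    have := H.continuous_limit
    fun_prop
  filter_upwards [hb, H.tendsto_perturbation κ hκ0, H.eventually_norm_flow_sub_le hκ0,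
    H.initial, H.hasDerivAt, self_mem_nhdsWithin] with ε hbε hB hΦ hi hd hε
  have hε0 : (0 : ℝ) < ε := hε
  have hy : ∀ s, HasDerivAt (fun s => ε⁻¹ * ℓ (Φ ε s x - x) - ∫ t in (0 : ℝ)..s, f t)
      (ℓ (B ε s (Φ ε s x)) - f s) s := fun s => by
    have h1 : HasDerivAt (fun s => Φ ε s x - x)
        ((g ε s • ρ.smulRight e + ε • B ε s) (Φ ε s x)) s := by
      simpa using ((hd s).clm_apply (hasDerivAt_const s x)).sub_const x
    have h2 := (ℓ.hasFDerivAt.comp_hasDerivAt s h1).const_mul ε⁻¹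
    -- As `ℓ e = 0`, the term that would be singular after division by `ε` disappears.
    have h3 : ε⁻¹ * ℓ ((g ε s • ρ.smulRight e + ε • B ε s) (Φ ε s x)) =
        ℓ (B ε s (Φ ε s x)) := by
      simp [hℓ, hε0.ne']
    rw [h3] at h2
    exact h2.sub (hfc.integral_hasStrictDerivAt 0 s).hasDerivAt
  have hbound : ∀ s ∈ Ico 0 T, ‖ℓ (B ε s (Φ ε s x)) - f s‖ ≤ η / 2 / (T + 1) := fun s hs => by
    have hs' := Ico_subset_Icc_self hs
    set φ := ContinuousLinearMap.id ℝ E + (s * α) • ρ.smulRight e with hφ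
    have h1 : ℓ (B ε s (Φ ε s x)) - f s =
        ℓ (B ε s ((Φ ε s - φ) x) + (B ε s - B₀ s) (φ x)) := by
      simp [hf, hφ, smul_smul]
    rw [h1]
    have h2 : ‖B ε s ((Φ ε s - φ) x)‖ ≤ b * (κ * ‖x‖) :=
      (ContinuousLinearMap.le_opNorm _ _).trans (mul_le_mul (hbε s hs')
        ((ContinuousLinearMap.le_opNorm _ _).trans (by gcongr; exact hΦ s hs'))
        (norm_nonneg _) hb0)
    have h3 : ‖(B ε s - B₀ s) (φ x)‖ ≤ κ * (c * ‖x‖) :=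
      (ContinuousLinearMap.le_opNorm _ _).trans (mul_le_mul (hB s hs')
        ((ContinuousLinearMap.le_opNorm _ _).trans (by gcongr; exact hc s hs'))
        (norm_nonneg _) hκ0.le)
    calc _ ≤ ‖ℓ‖ * (‖B ε s ((Φ ε s - φ) x)‖ + ‖(B ε s - B₀ s) (φ x)‖) :=
          (ℓ.le_opNorm _).trans (by gcongr; exact norm_add_le _ _)
      _ ≤ ‖ℓ‖ * (b * (κ * ‖x‖) + κ * (c * ‖x‖)) := by gcongr
      _ = κ * (b + c) * ‖x‖ * ‖ℓ‖ := by ring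
      _ ≤ κ * (b + c + 1) * (‖x‖ + 1) * (‖ℓ‖ + 1) := by gcongr κ * ?_ * ?_ * ?_ <;> linarith
      _ = _ := by rw [hκ]; field_simp
  have := norm_image_sub_le_of_norm_deriv_right_le_segment
    (f := fun s => ε⁻¹ * ℓ (Φ ε s x - x) - ∫ t in (0 : ℝ)..s, f t) (a := 0) (b := T)
    (fun s _ => (hy s).continuousAt.continuousWithinAt)
    (fun s _ => (hy s).hasDerivWithinAt) hbound T ⟨hT, le_rfl⟩
  simp only [hi, ContinuousLinearMap.id_apply, sub_self, map_zero, mul_zero,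
    intervalIntegral.integral_same, sub_zero] at this
  rw [Real.dist_eq, ← Real.norm_eq_abs]
  calc _ ≤ _ := this
    _ ≤ η / 2 / (T + 1) * (T + 1) := by gcongr; linarith
    _ = η / 2 := by field_simp
    _ < η := by linarith

end NilpotentPerturbation

end MonodromyAsymptotics

/-! ### Signs of determinants and real roots beyond a point -/

section Determinants

/-- A complex structure has positive determinant. -/
lemma det_pos_of_comp_self_eq_neg {V : Type*} [AddCommGroup V] [Module ℝ V]
    [FiniteDimensional ℝ V] {J : V →ₗ[ℝ] V} (hJ : ∀ x, J (J x) = -x) :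
    0 < LinearMap.det J := by
  -- Up to the factor 2, `J` is a square, so its determinant is nonnegative; it is nonzero because
  -- `J² = -1`.
  have h1 : (LinearMap.id + J) ∘ₗ (LinearMap.id + J) = (2 : ℝ) • J := by
    ext x
    simp only [LinearMap.comp_apply, LinearMap.add_apply, LinearMap.id_apply, map_add, hJ,
      two_smul]
    abel
  have h2 : J ∘ₗ J = -LinearMap.id := by
    ext x
    simp [hJ]
  have h3 := congrArg LinearMap.det h1
  rw [LinearMap.det_comp, LinearMap.det_smul] at h3
  have h4 : LinearMap.det J ≠ 0 := fun h0 => by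
    have := congrArg LinearMap.det h2
    rw [LinearMap.det_comp, h0, zero_mul] at this
    have h5 : (-LinearMap.id : V →ₗ[ℝ] V) = (-1 : ℝ) • LinearMap.id := by simp
    rw [h5, LinearMap.det_smul, LinearMap.det_id, mul_one] at this
    exact (pow_ne_zero _ (by norm_num : (-1 : ℝ) ≠ 0)) this.symm
  refine lt_of_le_of_ne ?_ h4.symm
  have h5 : 0 ≤ (2 : ℝ) ^ Module.finrank ℝ V * LinearMap.det J := h3 ▸ mul_self_nonneg _
  exact nonneg_of_mul_nonneg_right h5 (by positivity)

lemma exists_isRoot_gt_of_eval_neg {p : Polynomial ℝ} (hp : p.Monic) {x : ℝ}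
    (hx : p.eval x < 0) : ∃ y, x < y ∧ p.IsRoot y := by
  have hdeg : 0 < p.degree := by
    by_contra h
    rw [hp.degree_le_zero_iff_eq_one.1 (not_lt.1 h)] at hx
    norm_num at hx
  have ht := p.tendsto_atTop_of_leadingCoeff_nonneg hdeg (by rw [hp.leadingCoeff]; norm_num)
  obtain ⟨y, hy, hxy⟩ := ((ht.eventually_ge_atTop 0).and (eventually_gt_atTop x)).exists
  obtain ⟨w, hw, hw0⟩ := intermediate_value_Icc hxy.le p.continuous.continuousOn ⟨hx.le, hy⟩
  refine ⟨w, lt_of_le_of_ne hw.1 fun h => ?_, hw0⟩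
  rw [← h] at hw0
  exact hx.ne hw0

variable {κ : Type*} [Fintype κ] [DecidableEq κ]

lemma tendsto_det {n : Type*} [Fintype n] [DecidableEq n] {G : ℝ → Matrix n n ℝ}
    {K : Matrix n n ℝ} {l : Filter ℝ} (h : ∀ i j, Tendsto (fun ε => G ε i j) l (𝓝 (K i j))) :
    Tendsto (fun ε => (G ε).det) l (𝓝 K.det) :=
  ((Continuous.matrix_det continuous_id).tendsto K).comp
    (tendsto_pi_nhds.2 fun i => tendsto_pi_nhds.2 fun j => h i j)

/-- Sign of the determinant of a matrix whose second block of rows is of order `ε`. -/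
lemma eventually_det_neg_of_rows {W : ℝ → Matrix (Unit ⊕ κ) (Unit ⊕ κ) ℝ} {a : ℝ} {c : κ → ℝ}
    {K : Matrix κ κ ℝ}
    (h₁₁ : Tendsto (fun ε => W ε (Sum.inl ()) (Sum.inl ())) (𝓝[>] 0) (𝓝 a))
    (h₁₂ : ∀ j, Tendsto (fun ε => W ε (Sum.inl ()) (Sum.inr j)) (𝓝[>] 0) (𝓝 0))
    (h₂₁ : ∀ i, Tendsto (fun ε => ε⁻¹ * W ε (Sum.inr i) (Sum.inl ())) (𝓝[>] 0) (𝓝 (c i)))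
    (h₂₂ : ∀ i j, Tendsto (fun ε => ε⁻¹ * W ε (Sum.inr i) (Sum.inr j)) (𝓝[>] 0) (𝓝 (K i j)))
    (haK : a * K.det < 0) : ∀ᶠ ε in 𝓝[>] (0 : ℝ), (W ε).det < 0 := by
  -- Dividing the small rows by `ε` leaves a block lower triangular limit of determinant `a *
  -- K.det`; the column `c` does not enter.
  set D : ℝ → Unit ⊕ κ → ℝ := fun ε => Sum.elim (fun _ => 1) (fun _ => ε⁻¹)
  have h := tendsto_det (G := fun ε => Matrix.diagonal (D ε) * W ε)
    (K := Matrix.fromBlocks (Matrix.of fun _ _ => a) 0 (Matrix.of fun i _ => c i) K)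
    (l := 𝓝[>] 0) (by
      rintro (⟨⟩ | i) (⟨⟩ | j)
      · simpa [D, Matrix.diagonal_mul] using h₁₁
      · simpa [D, Matrix.diagonal_mul] using h₁₂ j
      · simpa [D, Matrix.diagonal_mul] using h₂₁ i
      · simpa [D, Matrix.diagonal_mul] using h₂₂ i j)
  rw [Matrix.det_fromBlocks_zero₁₂, Matrix.det_unique (n := Unit)] at h
  filter_upwards [h.eventually (gt_mem_nhds haK), self_mem_nhdsWithin] with ε hε hε0
  have : (0 : ℝ) < ε := hε0
  rw [Matrix.det_mul, Matrix.det_diagonal] at hε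
  have hD : 0 < ∏ i, D ε i := Finset.prod_pos fun i _ => by
    rcases i with _ | i
    · exact one_pos
    · exact inv_pos.2 this
  by_contra! hcon
  exact absurd hε (not_lt.2 (mul_nonneg hD.le hcon))

/-- The determinant of `√ε ν - W` when `W` is a perturbation of a nilpotent matrix with a coupling
of order `ε`. -/
lemma eventually_det_sub_neg {W : ℝ → Matrix (Unit ⊕ κ) (Unit ⊕ κ) ℝ} {c₀ ν : ℝ} {β γ : κ → ℝ}
    (h₁₁ : Tendsto (fun ε => ε⁻¹ * W ε (Sum.inl ()) (Sum.inl ())) (𝓝[>] 0) (𝓝 c₀))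
    (h₁₂ : ∀ j, Tendsto (fun ε => ε⁻¹ * W ε (Sum.inl ()) (Sum.inr j)) (𝓝[>] 0) (𝓝 (β j)))
    (h₂₁ : ∀ i, Tendsto (fun ε => W ε (Sum.inr i) (Sum.inl ())) (𝓝[>] 0) (𝓝 (γ i)))
    (h₂₂ : ∀ i j, ∃ C, ∀ᶠ ε in 𝓝[>] (0 : ℝ), |W ε (Sum.inr i) (Sum.inr j)| ≤ C * ε)
    (hν : 0 < ν) (hνβ : ν ^ 2 < ∑ j, β j * γ j) :
    ∀ᶠ ε in 𝓝[>] (0 : ℝ), (Matrix.scalar (Unit ⊕ κ) (√ε * ν) - W ε).det < 0 := by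
  -- With these row weights and the column weights `D'`, the diagonal `√ε ν` and both couplings, of
  -- orders `ε` and 1, become of order one, while the remaining entries of `W` vanish in the limit.
  set D : ℝ → Unit ⊕ κ → ℝ := fun ε => Sum.elim (fun _ => ε⁻¹) (fun _ => (√ε)⁻¹)
  set D' : ℝ → Unit ⊕ κ → ℝ := fun ε => Sum.elim (fun _ => √ε) (fun _ => 1)
  have hpos : ∀ᶠ ε in 𝓝[>] (0 : ℝ), 0 < ε := self_mem_nhdsWithin
  have hsqrt : Tendsto (fun ε : ℝ => √ε) (𝓝[>] 0) (𝓝 0) := by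
    have := Real.continuous_sqrt.tendsto 0
    rw [Real.sqrt_zero] at this
    exact this.mono_left nhdsWithin_le_nhds
  have h := tendsto_det
    (G := fun ε => Matrix.diagonal (D ε) * (Matrix.scalar (Unit ⊕ κ) (√ε * ν) - W ε) *
      Matrix.diagonal (D' ε))
    (K := Matrix.fromBlocks (Matrix.of fun _ _ => ν) (Matrix.of fun _ j => -β j)
      (Matrix.of fun i _ => -γ i) (Matrix.scalar κ ν))
    (l := 𝓝[>] 0) (by
      rintro (⟨⟩ | i) (⟨⟩ | j)
      · have : Tendsto (fun ε : ℝ => ν - √ε * (ε⁻¹ * W ε (Sum.inl ()) (Sum.inl ())))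
            (𝓝[>] 0) (𝓝 (ν - 0 * c₀)) := tendsto_const_nhds.sub (hsqrt.mul h₁₁)
        rw [zero_mul, sub_zero] at this
        refine this.congr' ?_
        filter_upwards [hpos] with ε hε
        have h2 : √ε * √ε = ε := Real.mul_self_sqrt hε.le
        have h3 : 0 < √ε := Real.sqrt_pos.2 hε
        simp only [D, D', Matrix.diagonal_mul, Matrix.mul_diagonal, Sum.elim_inl,
          Matrix.sub_apply, Matrix.scalar_apply, Matrix.diagonal_apply_eq]
        field_simp
        linear_combination (-ν) * h2
      · refine (h₁₂ j).neg.congr' ?_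
        filter_upwards [hpos] with ε hε
        simp [D, D', Matrix.diagonal_mul, Matrix.mul_diagonal]
      · refine (h₂₁ i).neg.congr' ?_
        filter_upwards [hpos] with ε hε
        have h3 : 0 < √ε := Real.sqrt_pos.2 hε
        simp only [D, D', Matrix.diagonal_mul, Matrix.mul_diagonal, Sum.elim_inl, Sum.elim_inr,
          Matrix.sub_apply, Matrix.scalar_apply, Matrix.diagonal_apply_ne _ (Sum.inr_ne_inl)]
        field_simp
        ring
      · obtain ⟨C, hC⟩ := h₂₂ i j
        have h4 : Tendsto (fun ε => (√ε)⁻¹ * W ε (Sum.inr i) (Sum.inr j)) (𝓝[>] 0) (𝓝 0) := by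
          refine squeeze_zero_norm' (a := fun ε => C * √ε) ?_ (by simpa using hsqrt.const_mul C)
          filter_upwards [hpos, hC] with ε hε hCε
          have h3 : 0 < √ε := Real.sqrt_pos.2 hε
          rw [norm_mul, norm_inv, Real.norm_of_nonneg h3.le, Real.norm_eq_abs,
            inv_mul_le_iff₀ h3]
          calc _ ≤ C * ε := hCε
            _ = C * (√ε * √ε) := by rw [Real.mul_self_sqrt hε.le]
            _ = _ := by ring
        have h5 := (tendsto_const_nhds (x := Matrix.scalar κ ν i j)).sub h4
        rw [sub_zero] at h5
        refine h5.congr' ?_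
        filter_upwards [hpos] with ε hε
        have h3 : 0 < √ε := Real.sqrt_pos.2 hε
        by_cases hij : i = j
        · subst hij
          simp only [D, D', Matrix.diagonal_mul, Matrix.mul_diagonal, Sum.elim_inr,
            Matrix.sub_apply, Matrix.scalar_apply, Matrix.diagonal_apply_eq]
          field_simp
        · simp [D, D', Matrix.diagonal_mul, Matrix.mul_diagonal, Matrix.diagonal_apply_ne _ hij,
            Matrix.diagonal_apply_ne _ (Sum.inr_injective.ne hij)])
  have hlim : (Matrix.fromBlocks (Matrix.of fun _ _ => ν) (Matrix.of fun _ j => -β j)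
      (Matrix.of fun i _ => -γ i) (Matrix.scalar κ ν) : Matrix (Unit ⊕ κ) (Unit ⊕ κ) ℝ).det
      < 0 := by
    let _ : Invertible (Matrix.scalar κ ν) :=
      ⟨Matrix.scalar κ ν⁻¹, by rw [← map_mul, inv_mul_cancel₀ hν.ne', map_one],
        by rw [← map_mul, mul_inv_cancel₀ hν.ne', map_one]⟩
    have hinv : ⅟(Matrix.scalar κ ν) = Matrix.scalar κ ν⁻¹ := rfl
    -- Schur complement of the scalar block: the sign is that of `ν ^ 2 - ∑ j, β j * γ j`.
    rw [Matrix.det_fromBlocks₂₂, Matrix.det_unique (n := Unit), hinv]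
    have h6 : ((Matrix.of fun _ _ => ν : Matrix Unit Unit ℝ) -
        (Matrix.of fun (_ : Unit) j => -β j) * Matrix.scalar κ ν⁻¹ *
          (Matrix.of fun i (_ : Unit) => -γ i)) default default =
        ν⁻¹ * (ν ^ 2 - ∑ j, β j * γ j) := by
      rw [Matrix.sub_apply, Matrix.mul_apply, mul_sub, Finset.mul_sum]
      simp only [Matrix.of_apply, Matrix.scalar_apply, Matrix.mul_diagonal]
      congr 1
      · field_simp
      · exact Finset.sum_congr rfl fun j _ => by ring
    rw [h6, Matrix.scalar_apply, Matrix.det_diagonal]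
    refine mul_neg_of_pos_of_neg (Finset.prod_pos fun _ _ => hν) ?_
    exact mul_neg_of_pos_of_neg (inv_pos.2 hν) (by linarith)
  filter_upwards [h.eventually (gt_mem_nhds hlim), hpos] with ε hε hε0
  rw [Matrix.det_mul, Matrix.det_mul, Matrix.det_diagonal, Matrix.det_diagonal] at hε
  have h3 : 0 < √ε := Real.sqrt_pos.2 hε0
  have hD : 0 < ∏ i, D ε i := Finset.prod_pos fun i _ => by
    rcases i with _ | i
    · exact inv_pos.2 hε0
    · exact inv_pos.2 h3
  have hD' : 0 < ∏ i, D' ε i := Finset.prod_pos fun i _ => by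
    rcases i with _ | i
    · exact h3
    · exact one_pos
  by_contra! hcon
  exact absurd hε (not_lt.2 (mul_nonneg (mul_nonneg hD.le hcon) hD'.le))

end Determinants

/-! ### Parameter integrals, uniform limits and Taylor remainders -/

section Calculus

variable {E F : Type*} [NormedAddCommGroup E] [NormedSpace ℝ E] [NormedAddCommGroup F]
  [NormedSpace ℝ F]

lemma continuousOn_iteratedFDeriv_fderiv {f : ℝ → E → F} {n : ℕ} {S : Set (ℝ × E)}
    (hf : ContinuousOn (fun x : ℝ × E => iteratedFDeriv ℝ (n + 1) (f x.1) x.2) S) :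
    ContinuousOn (fun x : ℝ × E => iteratedFDeriv ℝ n (fderiv ℝ (f x.1)) x.2) S := by
  refine ((continuousMultilinearCurryRightEquiv' ℝ n E F).continuous.comp_continuousOn hf).congr
    fun x _ => ?_
  simp [iteratedFDeriv_succ_eq_comp_right]

lemma continuousOn_of_iteratedFDeriv_zero {f : ℝ → E → F} {S : Set (ℝ × E)}
    (hf : ContinuousOn (fun x : ℝ × E => iteratedFDeriv ℝ 0 (f x.1) x.2) S) :
    ContinuousOn (fun x : ℝ × E => f x.1 x.2) S := by
  refine ((continuousMultilinearCurryFin0 ℝ E F).continuous.comp_continuousOn hf).congr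
    fun x _ => ?_
  simp [iteratedFDeriv_zero_eq_comp]

lemma smul_smulRight (c : ℝ) (ℓ : E →L[ℝ] ℝ) (v : F) :
    (c • ℓ).smulRight v = c • ℓ.smulRight v := by
  ext x
  simp [smul_smul]

/-- Differentiation under the integral sign for jointly continuous derivatives. -/
lemma hasFDerivAt_integral_of_continuousOn [ProperSpace E] [CompleteSpace F]
    {f : ℝ → E → F} {f' : ℝ → E → E →L[ℝ] F} {V : Set E} (hV : IsOpen V) (T : ℝ)
    (hf : ContinuousOn (fun x : ℝ × E => f x.1 x.2) (univ ×ˢ V))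
    (hf' : ContinuousOn (fun x : ℝ × E => f' x.1 x.2) (univ ×ˢ V))
    (hd : ∀ t, ∀ x ∈ V, HasFDerivAt (f t) (f' t x) x) {x : E} (hx : x ∈ V) :
    HasFDerivAt (fun y => ∫ t in (0 : ℝ)..T, f t y) (∫ t in (0 : ℝ)..T, f' t x) x := by
  obtain ⟨r, hr, hrV⟩ := Metric.nhds_basis_closedBall.mem_iff.1 (hV.mem_nhds hx)
  obtain ⟨C, hC⟩ := (isCompact_uIcc.prod (isCompact_closedBall x r)).exists_bound_of_continuousOn
    (s := uIcc 0 T ×ˢ Metric.closedBall x r)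
    (hf'.mono (prod_mono (subset_univ _) hrV))
  have hslice : ∀ y ∈ V, Continuous fun t => f t y := fun y hy =>
    hf.comp_continuous (f := fun t => (t, y)) (by fun_prop) fun t => ⟨mem_univ _, hy⟩
  have hslice' : Continuous fun t => f' t x :=
    hf'.comp_continuous (f := fun t => (t, x)) (by fun_prop) fun t => ⟨mem_univ _, hx⟩
  refine intervalIntegral.hasFDerivAt_integral_of_dominated_of_fderiv_le
    (F := fun y t => f t y) (F' := fun y t => f' t y) (bound := fun _ => C)
    (Metric.closedBall_mem_nhds x hr) ?_ ((hslice x hx).intervalIntegrable _ _)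
    hslice'.aestronglyMeasurable ?_ intervalIntegrable_const ?_
  · filter_upwards [hV.mem_nhds hx] with y hy
    exact (hslice y hy).aestronglyMeasurable
  · exact Eventually.of_forall fun t ht y hy => hC (t, y) ⟨uIoc_subset_uIcc ht, hy⟩
  · exact Eventually.of_forall fun t _ y hy => hd t y (hrV hy)

lemma eventually_forall_dist_le_of_continuousOn {M : Type*} [PseudoMetricSpace M]
    {f : ℝ × ℝ → M} {ε₀ : ℝ} (hε₀ : 0 < ε₀) (hf : ContinuousOn f (univ ×ˢ Ioo (-ε₀) ε₀))
    (T : ℝ) {η : ℝ} (hη : 0 < η) :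
    ∀ᶠ ε in 𝓝 (0 : ℝ), ∀ t ∈ Icc 0 T, dist (f (t, ε)) (f (t, 0)) ≤ η := by
  have hO : IsOpen ((univ : Set ℝ) ×ˢ Ioo (-ε₀) ε₀) := isOpen_univ.prod isOpen_Ioo
  refine isCompact_Icc.eventually_forall_of_forall_eventually fun t _ => ?_
  have h0 : (t, (0 : ℝ)) ∈ (univ : Set ℝ) ×ˢ Ioo (-ε₀) ε₀ := ⟨mem_univ _, by simpa⟩
  have hc : ContinuousAt f (t, 0) := hf.continuousAt (hO.mem_nhds h0)
  have h1 : Tendsto (fun z : ℝ × ℝ => f (z.2, z.1)) (𝓝 ((0 : ℝ), t)) (𝓝 (f (t, 0))) :=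
    hc.tendsto.comp (Continuous.tendsto' (f := fun z : ℝ × ℝ => (z.2, z.1)) (by fun_prop) _ _ rfl)
  have h2 : Tendsto (fun z : ℝ × ℝ => f (z.2, 0)) (𝓝 ((0 : ℝ), t)) (𝓝 (f (t, 0))) :=
    hc.tendsto.comp (Continuous.tendsto' (f := fun z : ℝ × ℝ => (z.2, (0 : ℝ)))
      (by fun_prop) _ _ rfl)
  have h3 := h1.dist h2
  rw [dist_self] at h3
  exact (h3.eventually (gt_mem_nhds hη)).mono fun z hz => hz.le

/-- Bounds for the increment and for the Taylor remainder from bounds for two derivatives. -/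
lemma norm_image_sub_le_of_fderiv_bounds {X : E → E} {X₂ : E → E →L[ℝ] E →L[ℝ] E} {ζ : E}
    {r L C : ℝ} (hX : ∀ y ∈ Metric.closedBall ζ r, DifferentiableAt ℝ X y)
    (hX₂ : ∀ y ∈ Metric.closedBall ζ r, HasFDerivAt (fderiv ℝ X) (X₂ y) y)
    (hL : ∀ y ∈ Metric.closedBall ζ r, ‖fderiv ℝ X y‖ ≤ L)
    (hC : ∀ y ∈ Metric.closedBall ζ r, ‖X₂ y‖ ≤ C) {y : E} (hy : y ∈ Metric.closedBall ζ r) :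
    ‖X y - X ζ‖ ≤ L * ‖y - ζ‖ ∧ ‖X y - X ζ - fderiv ℝ X ζ (y - ζ)‖ ≤ C * ‖y - ζ‖ ^ 2 := by
  have hr : 0 ≤ r := dist_nonneg.trans hy
  have hζ : ζ ∈ Metric.closedBall ζ r := Metric.mem_closedBall_self hr
  have hC0 : 0 ≤ C := (norm_nonneg _).trans (hC ζ hζ)
  refine ⟨(convex_closedBall ζ r).norm_image_sub_le_of_norm_fderiv_le hX hL hζ hy, ?_⟩
  have hsub : Metric.closedBall ζ ‖y - ζ‖ ⊆ Metric.closedBall ζ r := fun x hx =>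
    (Metric.mem_closedBall.1 hx).trans (by rw [← dist_eq_norm]; exact hy)
  rw [pow_two, ← mul_assoc]
  -- On the smaller ball of radius `‖y - ζ‖` the derivative differs from its value at `ζ` by at most
  -- `C * ‖y - ζ‖`.
  refine (convex_closedBall ζ ‖y - ζ‖).norm_image_sub_le_of_norm_fderiv_le'
    (fun x hx => hX x (hsub hx)) (fun x hx => ?_)
    (Metric.mem_closedBall_self (norm_nonneg _)) (by simp [dist_eq_norm])
  refine ((convex_closedBall ζ r).norm_image_sub_le_of_norm_hasFDerivWithin_le
    (fun w hw => (hX₂ w hw).hasFDerivWithinAt) hC hζ (hsub hx)).trans ?_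
  gcongr
  rw [← dist_eq_norm]
  exact hx

end Calculus

/-! ### The symplectic gradient and the derivatives of the Hamiltonian field -/

variable {d : ℕ}

/-- The coordinate `r`. -/
noncomputable def actionCoord (d : ℕ) : Phase d →L[ℝ] ℝ :=
  (ContinuousLinearMap.fst ℝ ℝ (Fin d → ℝ)).comp
    ((ContinuousLinearMap.snd ℝ (Fin d → ℝ) (ℝ × (Fin d → ℝ))).comp
      (ContinuousLinearMap.snd ℝ ℝ ((Fin d → ℝ) × ℝ × (Fin d → ℝ))))

@[simp] lemma actionCoord_apply (z : Phase d) : actionCoord d z = z.2.2.1 := rfl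

/-- The unit vector in the direction of the angle. -/
def angleVec (d : ℕ) : Phase d := (1, 0, 0, 0)

/-- The symplectic gradient of a linear form. -/
noncomputable def symplecticGrad (d : ℕ) : (Phase d →L[ℝ] ℝ) →L[ℝ] Phase d :=
  (ContinuousLinearMap.apply ℝ ℝ ((0, 0, 1, 0) : Phase d)).prod
    ((ContinuousLinearMap.pi fun i =>
        ContinuousLinearMap.apply ℝ ℝ ((0, 0, 0, Pi.single i 1) : Phase d)).prod
      ((-ContinuousLinearMap.apply ℝ ℝ ((1, 0, 0, 0) : Phase d)).prod
        (ContinuousLinearMap.pi fun i =>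
          -ContinuousLinearMap.apply ℝ ℝ ((0, Pi.single i 1, 0, 0) : Phase d))))

lemma hamiltonianField_eq (K : Phase d → ℝ) (z : Phase d) :
    hamiltonianField K z = symplecticGrad d (fderiv ℝ K z) := rfl

lemma symplecticGrad_apply (f : Phase d →L[ℝ] ℝ) :
    symplecticGrad d f = (f (0, 0, 1, 0), fun i => f (0, 0, 0, Pi.single i 1),
      -f (1, 0, 0, 0), fun i => -f (0, Pi.single i 1, 0, 0)) := rfl

lemma symplecticGrad_actionCoord : symplecticGrad d (actionCoord d) = angleVec d := by
  rw [symplecticGrad_apply]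
  ext <;> simp [angleVec]

section Field

variable {I : Set ℝ} {D : ℝ → Set ((Fin d → ℝ) × (Fin d → ℝ))} {h : ℝ → ℝ}
  {U : ℝ → Phase d → ℝ}

/-- The Hessian of the Hamiltonian. -/
noncomputable def hamiltonianHessian (h : ℝ → ℝ) (U : ℝ → Phase d → ℝ) (ε t : ℝ) (z : Phase d) :
    Phase d →L[ℝ] Phase d →L[ℝ] ℝ :=
  deriv (deriv h) z.2.2.1 • (actionCoord d).smulRight (actionCoord d) -
    ε • fderiv ℝ (fderiv ℝ (U t)) z

/-- The third derivative of the Hamiltonian. -/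
noncomputable def hamiltonianThird (h : ℝ → ℝ) (U : ℝ → Phase d → ℝ) (ε t : ℝ) (z : Phase d) :
    Phase d →L[ℝ] Phase d →L[ℝ] Phase d →L[ℝ] ℝ :=
  deriv (deriv (deriv h)) z.2.2.1 •
      (actionCoord d).smulRight ((actionCoord d).smulRight (actionCoord d)) -
    ε • fderiv ℝ (fderiv ℝ (fderiv ℝ (U t))) z

lemma hasDerivAt_deriv_of_contDiffOn {f : ℝ → ℝ} {n : WithTop ℕ∞} (hI : IsOpen I) (hn : 1 ≤ n)
    (hf : ContDiffOn ℝ n f I) {r : ℝ} (hr : r ∈ I) : HasDerivAt f (deriv f r) r :=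
  ((hf.differentiableOn (by intro h0; simp [h0] at hn)).differentiableAt
    (hI.mem_nhds hr)).hasDerivAt

lemma hasFDerivAt_comp_action {f : ℝ → ℝ} {z : Phase d}
    (hf : HasDerivAt f (deriv f z.2.2.1) z.2.2.1) :
    HasFDerivAt (fun z : Phase d => f z.2.2.1) (deriv f z.2.2.1 • actionCoord d) z :=
  hf.comp_hasFDerivAt z (actionCoord d).hasFDerivAt

lemma IsC03.differentiableAt {Ω : Set (Phase d)} (hU : IsC03 U Ω) (hΩ : IsOpen Ω) (t : ℝ)
    {z : Phase d} (hz : z ∈ Ω) :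
    DifferentiableAt ℝ (U t) z ∧ DifferentiableAt ℝ (fderiv ℝ (U t)) z ∧
      DifferentiableAt ℝ (fderiv ℝ (fderiv ℝ (U t))) z := by
  have h1 := (hU.contDiffOn t).fderiv_of_isOpen hΩ (m := 2) (by norm_num)
  have h2 := h1.fderiv_of_isOpen hΩ (m := 1) (by norm_num)
  exact ⟨((hU.contDiffOn t).differentiableOn (by norm_num)).differentiableAt (hΩ.mem_nhds hz),
    (h1.differentiableOn (by norm_num)).differentiableAt (hΩ.mem_nhds hz),
    (h2.differentiableOn (by norm_num)).differentiableAt (hΩ.mem_nhds hz)⟩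

lemma IsC03.continuousOn_fderiv {Ω : Set (Phase d)} (hU : IsC03 U Ω) :
    ContinuousOn (fun x : ℝ × Phase d => U x.1 x.2) (univ ×ˢ Ω) ∧
    ContinuousOn (fun x : ℝ × Phase d => fderiv ℝ (U x.1) x.2) (univ ×ˢ Ω) ∧
    ContinuousOn (fun x : ℝ × Phase d => fderiv ℝ (fderiv ℝ (U x.1)) x.2) (univ ×ˢ Ω) ∧
    ContinuousOn (fun x : ℝ × Phase d => fderiv ℝ (fderiv ℝ (fderiv ℝ (U x.1))) x.2)
      (univ ×ˢ Ω) := by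
  refine ⟨continuousOn_of_iteratedFDeriv_zero (hU.continuousOn 0 (by norm_num)),
    continuousOn_of_iteratedFDeriv_zero (f := fun t => fderiv ℝ (U t))
      (continuousOn_iteratedFDeriv_fderiv (hU.continuousOn 1 (by norm_num))),
    continuousOn_of_iteratedFDeriv_zero (f := fun t => fderiv ℝ (fderiv ℝ (U t)))
      (continuousOn_iteratedFDeriv_fderiv (f := fun t => fderiv ℝ (U t))
        (continuousOn_iteratedFDeriv_fderiv (hU.continuousOn 2 (by norm_num)))),
    continuousOn_of_iteratedFDeriv_zero (f := fun t => fderiv ℝ (fderiv ℝ (fderiv ℝ (U t))))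
      (continuousOn_iteratedFDeriv_fderiv (f := fun t => fderiv ℝ (fderiv ℝ (U t)))
        (continuousOn_iteratedFDeriv_fderiv (f := fun t => fderiv ℝ (U t))
          (continuousOn_iteratedFDeriv_fderiv (hU.continuousOn 3 (by norm_num)))))⟩

lemma hasFDerivAt_hamiltonian (hI : IsOpen I) (hΩ : IsOpen (phaseSpace I D))
    (hh : ContDiffOn ℝ 3 h I) (hU : IsC03 U (phaseSpace I D)) (ε t : ℝ) {z : Phase d}
    (hz : z ∈ phaseSpace I D) :
    HasFDerivAt (hamiltonian h U ε t)
      (deriv h z.2.2.1 • actionCoord d - ε • fderiv ℝ (U t) z) z :=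
  (hasFDerivAt_comp_action (hasDerivAt_deriv_of_contDiffOn hI (by norm_num) hh hz.1)).sub
    ((hU.differentiableAt hΩ t hz).1.hasFDerivAt.const_smul ε)

lemma hasFDerivAt_field (hI : IsOpen I) (hΩ : IsOpen (phaseSpace I D))
    (hh : ContDiffOn ℝ 3 h I) (hU : IsC03 U (phaseSpace I D)) (ε t : ℝ) {z : Phase d}
    (hz : z ∈ phaseSpace I D) :
    HasFDerivAt (field h U ε t) ((symplecticGrad d).comp (hamiltonianHessian h U ε t z)) z := by
  have h2 : ContDiffOn ℝ 2 (deriv h) I := hh.deriv_of_isOpen hI (by norm_num)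
  have h3 : HasFDerivAt (fun z : Phase d => deriv h z.2.2.1 • actionCoord d -
      ε • fderiv ℝ (U t) z) (hamiltonianHessian h U ε t z) z := by
    refine HasFDerivAt.sub ?_ ((hU.differentiableAt hΩ t hz).2.1.hasFDerivAt.const_smul ε)
    refine ((hasFDerivAt_comp_action (hasDerivAt_deriv_of_contDiffOn hI (by norm_num) h2
      hz.1)).smul_const (actionCoord d)).congr_fderiv ?_
    exact smul_smulRight _ _ _
  refine ((symplecticGrad d).hasFDerivAt.comp z h3).congr_of_eventuallyEq ?_
  filter_upwards [hΩ.mem_nhds hz] with w hw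
  rw [Function.comp_apply, ← (hasFDerivAt_hamiltonian hI hΩ hh hU ε t hw).fderiv]
  rfl

lemma hasFDerivAt_fderiv_field (hI : IsOpen I) (hΩ : IsOpen (phaseSpace I D))
    (hh : ContDiffOn ℝ 3 h I) (hU : IsC03 U (phaseSpace I D)) (ε t : ℝ) {z : Phase d}
    (hz : z ∈ phaseSpace I D) :
    HasFDerivAt (fderiv ℝ (field h U ε t))
      ((ContinuousLinearMap.compL ℝ (Phase d) (Phase d →L[ℝ] ℝ) (Phase d)
        (symplecticGrad d)).comp (hamiltonianThird h U ε t z)) z := by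
  have h2 : ContDiffOn ℝ 2 (deriv h) I := hh.deriv_of_isOpen hI (by norm_num)
  have h3 : ContDiffOn ℝ 1 (deriv (deriv h)) I := h2.deriv_of_isOpen hI (by norm_num)
  have h4 : HasFDerivAt (hamiltonianHessian h U ε t) (hamiltonianThird h U ε t z) z := by
    refine HasFDerivAt.sub ?_ ((hU.differentiableAt hΩ t hz).2.2.hasFDerivAt.const_smul ε)
    refine ((hasFDerivAt_comp_action (hasDerivAt_deriv_of_contDiffOn hI le_rfl h3
      hz.1)).smul_const ((actionCoord d).smulRight (actionCoord d))).congr_fderiv ?_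
    exact smul_smulRight _ _ _
  refine ((ContinuousLinearMap.compL ℝ (Phase d) (Phase d →L[ℝ] ℝ) (Phase d)
    (symplecticGrad d)).hasFDerivAt.comp z h4).congr_of_eventuallyEq ?_
  filter_upwards [hΩ.mem_nhds hz] with w hw
  exact (hasFDerivAt_field hI hΩ hh hU ε t hw).fderiv

lemma continuousOn_hamiltonianHessian (hI : IsOpen I) (hh : ContDiffOn ℝ 3 h I)
    (hU : IsC03 U (phaseSpace I D)) (ε : ℝ) :
    ContinuousOn (fun x : ℝ × Phase d => hamiltonianHessian h U ε x.1 x.2)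
      (univ ×ˢ phaseSpace I D) := by
  have h2 : ContDiffOn ℝ 2 (deriv h) I := hh.deriv_of_isOpen hI (by norm_num)
  have h3 : ContDiffOn ℝ 1 (deriv (deriv h)) I := h2.deriv_of_isOpen hI (by norm_num)
  exact ((h3.continuousOn.comp (f := fun x : ℝ × Phase d => x.2.2.2.1) (by fun_prop)
    fun x hx => hx.2.1).smul continuousOn_const).sub
    (hU.continuousOn_fderiv.2.2.1.const_smul ε)

lemma continuousOn_hamiltonianThird (hI : IsOpen I) (hh : ContDiffOn ℝ 3 h I)
    (hU : IsC03 U (phaseSpace I D)) (ε : ℝ) :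
    ContinuousOn (fun x : ℝ × Phase d => hamiltonianThird h U ε x.1 x.2)
      (univ ×ˢ phaseSpace I D) := by
  have h2 : ContDiffOn ℝ 2 (deriv h) I := hh.deriv_of_isOpen hI (by norm_num)
  have h3 : ContDiffOn ℝ 1 (deriv (deriv h)) I := h2.deriv_of_isOpen hI (by norm_num)
  have h4 : ContinuousOn (deriv (deriv (deriv h))) I :=
    h3.continuousOn_deriv_of_isOpen hI le_rfl
  exact ((h4.comp (f := fun x : ℝ × Phase d => x.2.2.2.1) (by fun_prop)
    fun x hx => hx.2.1).smul continuousOn_const).sub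
    (hU.continuousOn_fderiv.2.2.2.const_smul ε)

end Field

/-! ### Translation invariance, tube estimates and instability -/

section Periodicity

variable {d : ℕ} {I : Set ℝ} {D : ℝ → Set ((Fin d → ℝ) × (Fin d → ℝ))} {h : ℝ → ℝ}
  {U : ℝ → Phase d → ℝ} {ε : ℝ} {z : ℝ → Phase d}

lemma add_smul_angleVec (c : ℝ) (z : Phase d) : z + c • angleVec d = (z.1 + c, z.2) := by
  obtain ⟨θ, q, r, p⟩ := z
  simp [angleVec]

lemma add_smul_angleVec_mem (c : ℝ) {z : Phase d} (hz : z ∈ phaseSpace I D) :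
    z + c • angleVec d ∈ phaseSpace I D := by
  rw [add_smul_angleVec]
  exact hz

lemma field_add_period (hΩ : IsOpen (phaseSpace I D)) (hU : IsC03 U (phaseSpace I D))
    (t : ℝ) {y : Phase d} (hy : y ∈ phaseSpace I D) :
    field h U ε (t + 2 * Real.pi) y = field h U ε t y := by
  have : hamiltonian h U ε (t + 2 * Real.pi) =ᶠ[𝓝 y] hamiltonian h U ε t := by
    filter_upwards [hΩ.mem_nhds hy] with w hw
    simp only [hamiltonian, hU.periodic_time t w hw]
  simp only [field, hamiltonianField_eq, this.fderiv_eq]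

lemma field_add_angle (hΩ : IsOpen (phaseSpace I D)) (hU : IsC03 U (phaseSpace I D))
    (t : ℝ) {y : Phase d} (hy : y ∈ phaseSpace I D) :
    field h U ε t (y + (2 * Real.pi) • angleVec d) = field h U ε t y := by
  have : (fun w => hamiltonian h U ε t (w + (2 * Real.pi) • angleVec d)) =ᶠ[𝓝 y]
      hamiltonian h U ε t := by
    filter_upwards [hΩ.mem_nhds hy] with w hw
    rw [add_smul_angleVec]
    simp only [hamiltonian, hU.periodic_angle t w hw]
  simp only [field, hamiltonianField_eq, ← this.fderiv_eq, fderiv_comp_add_right]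

lemma field_add_int_mul_period (hΩ : IsOpen (phaseSpace I D)) (hU : IsC03 U (phaseSpace I D))
    (k : ℤ) (t : ℝ) {y : Phase d} (hy : y ∈ phaseSpace I D) :
    field h U ε (t + k * (2 * Real.pi)) y = field h U ε t y := by
  have := Function.Periodic.int_mul (f := fun t => field h U ε t y) (c := 2 * Real.pi)
    (fun t => field_add_period hΩ hU t hy) k t
  simpa using this

lemma field_add_int_mul_angle (hΩ : IsOpen (phaseSpace I D)) (hU : IsC03 U (phaseSpace I D))
    (m : ℤ) (t : ℝ) {y : Phase d} (hy : y ∈ phaseSpace I D) :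
    field h U ε t (y + (m * (2 * Real.pi)) • angleVec d) = field h U ε t y := by
  have := Function.Periodic.int_mul
    (f := fun s : ℝ => field h U ε t (y + s • angleVec d)) (c := 2 * Real.pi)
    (fun s => by
      dsimp only
      rw [add_smul, ← add_assoc, field_add_angle hΩ hU t (add_smul_angleVec_mem s hy)]) m 0
  simpa using this

/-- Translation of the field by a common period. -/
lemma field_translate (hΩ : IsOpen (phaseSpace I D)) (hU : IsC03 U (phaseSpace I D))
    (k m : ℤ) (t : ℝ) {y : Phase d} (hy : y ∈ phaseSpace I D) :
    field h U ε (t + k * (2 * Real.pi)) (y + (m * (2 * Real.pi)) • angleVec d) =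
      field h U ε t y := by
  rw [field_add_int_mul_angle hΩ hU m _ hy, field_add_int_mul_period hΩ hU k t hy]

lemma fderiv_field_translate (hΩ : IsOpen (phaseSpace I D)) (hU : IsC03 U (phaseSpace I D))
    (k m : ℤ) (t : ℝ) {y : Phase d} (hy : y ∈ phaseSpace I D) :
    fderiv ℝ (field h U ε (t + k * (2 * Real.pi))) (y + (m * (2 * Real.pi)) • angleVec d) =
      fderiv ℝ (field h U ε t) y := by
  rw [← fderiv_comp_add_right]
  refine Filter.EventuallyEq.fderiv_eq ?_
  filter_upwards [hΩ.mem_nhds hy] with w hw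
  exact field_translate hΩ hU k m t hw

/-- In the lift the angle advances by whole turns, and the field is invariant under these
translations; so the variational coefficient is periodic although the lifted solution need not be.
-/
lemma IsPeriodicSolution.exists_translate {X : ℝ → Phase d → Phase d} {Ω : Set (Phase d)}
    (hz : IsPeriodicSolution X Ω z) (k : ℤ) (t : ℝ) :
    ∃ m : ℤ, z (t + k * (2 * Real.pi)) = z t + (m * (2 * Real.pi)) • angleVec d := by
  have hstep : ∀ s, ∃ m : ℤ, z (s + 2 * Real.pi) = z s + (m * (2 * Real.pi)) • angleVec d :=
    fun s => by
      obtain ⟨m, hm⟩ := Real.Angle.angle_eq_iff_two_pi_dvd_sub.1 (hz.periodic_angle s)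
      refine ⟨m, ?_⟩
      rw [add_smul_angleVec]
      exact Prod.ext (by linarith) (hz.periodic s)
  induction k using Int.induction_on with
  | zero => exact ⟨0, by simp⟩
  | succ n ih =>
    obtain ⟨m, hm⟩ := ih
    obtain ⟨m', hm'⟩ := hstep (t + (n : ℤ) * (2 * Real.pi))
    refine ⟨m + m', ?_⟩
    have h1 : t + ((n + 1 : ℤ) : ℝ) * (2 * Real.pi) =
        t + (n : ℤ) * (2 * Real.pi) + 2 * Real.pi := by push_cast; ring
    rw [h1, hm', hm]
    push_cast
    module
  | pred n ih =>
    obtain ⟨m, hm⟩ := ih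
    obtain ⟨m', hm'⟩ := hstep (t + ((-n - 1 : ℤ) : ℝ) * (2 * Real.pi))
    refine ⟨m - m', ?_⟩
    have h1 : t + ((-n - 1 : ℤ) : ℝ) * (2 * Real.pi) + 2 * Real.pi =
        t + ((-n : ℤ) : ℝ) * (2 * Real.pi) := by push_cast; ring
    rw [h1, hm] at hm'
    rw [eq_sub_of_add_eq hm'.symm]
    push_cast
    module

lemma IsPeriodicSolution.variationalCoeff_periodic (hΩ : IsOpen (phaseSpace I D))
    (hU : IsC03 U (phaseSpace I D))
    (hz : IsPeriodicSolution (field h U ε) (phaseSpace I D) z) (t : ℝ) :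
    variationalCoeff (field h U ε) z (t + 2 * Real.pi) =
      variationalCoeff (field h U ε) z t := by
  obtain ⟨m, hm⟩ := hz.exists_translate 1 t
  have := fderiv_field_translate (h := h) (ε := ε) hΩ hU 1 m t (hz.mem t)
  rw [← hm] at this
  simpa [variationalCoeff] using this

/-- Uniform estimates for the field in a tube around a periodic solution. -/
lemma IsPeriodicSolution.exists_tube_estimates (hI : IsOpen I) (hΩ : IsOpen (phaseSpace I D))
    (hh : ContDiffOn ℝ 3 h I) (hU : IsC03 U (phaseSpace I D))
    (hz : IsPeriodicSolution (field h U ε) (phaseSpace I D) z) :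
    ∃ η₀ L C : ℝ, 0 < η₀ ∧ 0 < L ∧ 0 ≤ C ∧
      (∀ t, ‖variationalCoeff (field h U ε) z t‖ ≤ L) ∧
      ∀ t y, ‖y - z t‖ ≤ η₀ → y ∈ phaseSpace I D ∧
        ‖field h U ε t y - field h U ε t (z t)‖ ≤ L * ‖y - z t‖ ∧
        ‖field h U ε t y - field h U ε t (z t) -
          variationalCoeff (field h U ε) z t (y - z t)‖ ≤ C * ‖y - z t‖ ^ 2 := by
  have hzc : Continuous z := continuous_iff_continuousAt.2 fun t => (hz.hasDerivAt t).continuousAt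
  have hK : IsCompact (z '' Icc 0 (2 * Real.pi)) := isCompact_Icc.image hzc
  obtain ⟨η₀, hη₀, hsub⟩ := hK.exists_cthickening_subset_open hΩ
    (image_subset_iff.2 fun t _ => hz.mem t)
  have hcpt : IsCompact (Icc 0 (2 * Real.pi) ×ˢ
      Metric.cthickening η₀ (z '' Icc 0 (2 * Real.pi))) :=
    isCompact_Icc.prod hK.cthickening
  obtain ⟨L, hL⟩ := hcpt.exists_bound_of_continuousOn
    (((ContinuousLinearMap.compL ℝ (Phase d) (Phase d →L[ℝ] ℝ) (Phase d)
      (symplecticGrad d)).continuous.comp_continuousOn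
        (continuousOn_hamiltonianHessian hI hh hU ε)).mono (prod_mono (subset_univ _) hsub))
  obtain ⟨C, hC⟩ := hcpt.exists_bound_of_continuousOn
    (((ContinuousLinearMap.compL ℝ (Phase d) (Phase d →L[ℝ] Phase d →L[ℝ] ℝ)
      (Phase d →L[ℝ] Phase d)
      (ContinuousLinearMap.compL ℝ (Phase d) (Phase d →L[ℝ] ℝ) (Phase d)
      (symplecticGrad d))).continuous.comp_continuousOn
        (continuousOn_hamiltonianThird hI hh hU ε)).mono (prod_mono (subset_univ _) hsub))
  have hball : ∀ τ ∈ Icc 0 (2 * Real.pi), Metric.closedBall (z τ) η₀ ⊆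
      Metric.cthickening η₀ (z '' Icc 0 (2 * Real.pi)) := fun τ hτ =>
    Metric.closedBall_subset_cthickening (mem_image_of_mem z hτ) η₀
  have hLτ : ∀ τ ∈ Icc 0 (2 * Real.pi), ∀ y ∈ Metric.closedBall (z τ) η₀,
      ‖fderiv ℝ (field h U ε τ) y‖ ≤ max L 1 := fun τ hτ y hy => by
    rw [(hasFDerivAt_field hI hΩ hh hU ε τ (hsub (hball τ hτ hy))).fderiv]
    exact (hL (τ, y) ⟨hτ, hball τ hτ hy⟩).trans (le_max_left _ _)
  -- Every time is carried into one period, where the compact tube provides the constants; the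
  -- estimates then return by translation.
  have hred : ∀ t, ∃ τ ∈ Icc 0 (2 * Real.pi), ∃ k m : ℤ, t = τ + k * (2 * Real.pi) ∧
      z t = z τ + (m * (2 * Real.pi)) • angleVec d := fun t => by
    obtain ⟨k, hk, -⟩ := existsUnique_add_zsmul_mem_Ico Real.two_pi_pos t 0
    rw [zero_add, zsmul_eq_mul] at hk
    have ht : t = (t + k * (2 * Real.pi)) + ((-k : ℤ) : ℝ) * (2 * Real.pi) := by
      push_cast; ring
    obtain ⟨m, hm⟩ := hz.exists_translate (-k) (t + k * (2 * Real.pi))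
    rw [← ht] at hm
    exact ⟨_, Ico_subset_Icc_self hk, -k, m, ht, hm⟩
  refine ⟨η₀, max L 1, max C 0, hη₀, lt_max_of_lt_right one_pos, le_max_right _ _,
    fun t => ?_, fun t y hy => ?_⟩
  · obtain ⟨τ, hτ, k, m, ht, hm⟩ := hred t
    have h1 := fderiv_field_translate (h := h) (ε := ε) hΩ hU k m τ (hz.mem τ)
    rw [← ht, ← hm] at h1
    rw [variationalCoeff, h1]
    exact hLτ τ hτ _ (Metric.mem_closedBall_self hη₀.le)
  · obtain ⟨τ, hτ, k, m, ht, hm⟩ := hred t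
    set c : Phase d := (m * (2 * Real.pi)) • angleVec d with hc
    have hyc : (y - c) - z τ = y - z t := by rw [hm]; abel
    have hyb : y - c ∈ Metric.closedBall (z τ) η₀ := by
      rwa [Metric.mem_closedBall, dist_eq_norm, hyc]
    have hyΩ : y - c ∈ phaseSpace I D := hsub (hball τ hτ hyb)
    have h0 := field_translate (h := h) (ε := ε) hΩ hU k m τ hyΩ
    have h1 := field_translate (h := h) (ε := ε) hΩ hU k m τ (hz.mem τ)
    have h2 := fderiv_field_translate (h := h) (ε := ε) hΩ hU k m τ (hz.mem τ)
    rw [← ht, ← hm] at h1 h2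
    rw [← ht, ← hc, sub_add_cancel] at h0
    rw [variationalCoeff, h0, h1, h2, ← hyc]
    have hmem : y ∈ phaseSpace I D := by
      simpa [hc] using add_smul_angleVec_mem (m * (2 * Real.pi)) hyΩ
    exact ⟨hmem, norm_image_sub_le_of_fderiv_bounds
      (fun w hw => (hasFDerivAt_field hI hΩ hh hU ε τ (hsub (hball τ hτ hw))).differentiableAt)
      (fun w hw => hasFDerivAt_fderiv_field hI hΩ hh hU ε τ (hsub (hball τ hτ hw)))
      (hLτ τ hτ)
      (fun w hw => (hC (τ, w) ⟨hτ, hball τ hτ hw⟩).trans (le_max_left _ _)) hyb⟩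

/-- A Floquet multiplier outside the closed unit disc implies instability. -/
lemma IsPeriodicSolution.not_lyapunovStable (hI : IsOpen I) (hΩ : IsOpen (phaseSpace I D))
    (hh : ContDiffOn ℝ 3 h I) (hU : IsC03 U (phaseSpace I D))
    (hz : IsPeriodicSolution (field h U ε) (phaseSpace I D) z) {μ : ℂ} (hμ : 1 < ‖μ‖)
    (hmult : IsFloquetMultiplier (variationalCoeff (field h U ε) z) μ) :
    ¬ LyapunovStable (field h U ε) (phaseSpace I D) z := by
  obtain ⟨Φ, hΦ0, hΦ, hroot⟩ := hmult
  obtain ⟨η₀, L, C, hη₀, hL, hC, hAL, htube⟩ := hz.exists_tube_estimates hI hΩ hh hU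
  obtain ⟨η, hη, hesc⟩ := exists_escape_of_multiplier Real.two_pi_pos hL hC hη₀
    (hz.variationalCoeff_periodic hΩ hU) hAL hΦ0 hΦ hz.hasDerivAt
    (fun t y hy => (htube t y hy).2.1) (fun t y hy => (htube t y hy).2.2) hμ hroot
  intro hst
  obtain ⟨δ, hδ, hstab⟩ := hst η hη
  -- The bound `η₀` puts the starting point in the tube, hence in `Ω`, as stability requires.
  obtain ⟨w₀, hw₀, hw⟩ := hesc (min δ η₀) (lt_min hδ hη₀)
  obtain ⟨w, hww₀, hsol, hclose⟩ := hstab w₀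
    (htube 0 w₀ (hw₀.le.trans (min_le_right _ _))).1
    (by rw [dist_eq_norm]; exact hw₀.trans_le (min_le_left _ _))
  obtain ⟨t, ht, hle⟩ := hw w hww₀ fun t ht => (hsol t ht).2
  have := hclose t ht
  rw [dist_eq_norm] at this
  exact absurd this (not_lt.2 hle)

end Periodicity

/-! ### Second derivatives of parameter integrals -/

section SecondDerivative

variable {H P : Type*} [NormedAddCommGroup H] [NormedSpace ℝ H] [ProperSpace H]
  [NormedAddCommGroup P] [NormedSpace ℝ P]

/-- Second derivatives of a parameter integral along affine maps with a common linear part. -/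
lemma fderiv_fderiv_integral_affine {u : ℝ → P → ℝ} {Ω : Set P} {V : Set H} (hV : IsOpen V)
    (hc0 : ContinuousOn (fun x : ℝ × P => u x.1 x.2) (univ ×ˢ Ω))
    (hc1 : ContinuousOn (fun x : ℝ × P => fderiv ℝ (u x.1) x.2) (univ ×ˢ Ω))
    (hc2 : ContinuousOn (fun x : ℝ × P => fderiv ℝ (fderiv ℝ (u x.1)) x.2) (univ ×ˢ Ω))
    (hd1 : ∀ t, ∀ z ∈ Ω, DifferentiableAt ℝ (u t) z)
    (hd2 : ∀ t, ∀ z ∈ Ω, DifferentiableAt ℝ (fderiv ℝ (u t)) z)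
    (g : H →L[ℝ] P) {c : ℝ → P} (hc : Continuous c) (hVm : ∀ t, ∀ x ∈ V, g x + c t ∈ Ω)
    (a T : ℝ) {x₀ : H} (hx₀ : x₀ ∈ V) (v w : H) :
    fderiv ℝ (fun y => fderiv ℝ (fun x => a * ∫ t in (0 : ℝ)..T, u t (g x + c t)) y v) x₀ w =
      a * ∫ t in (0 : ℝ)..T, fderiv ℝ (fderiv ℝ (u t)) (g x₀ + c t) (g w) (g v) := by
  have hζd : ∀ t x, HasFDerivAt (fun x => g x + c t) g x := fun t x =>
    g.hasFDerivAt.add_const _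
  have hmap : ContinuousOn (fun x : ℝ × H => (x.1, g x.2 + c x.1)) (univ ×ˢ V) :=
    Continuous.continuousOn (by fun_prop)
  have hmaps : MapsTo (fun x : ℝ × H => (x.1, g x.2 + c x.1)) (univ ×ˢ V) (univ ×ˢ Ω) :=
    fun x hx => ⟨mem_univ _, hVm _ _ hx.2⟩
  have hF1 : ∀ x ∈ V, HasFDerivAt (fun y => ∫ t in (0 : ℝ)..T, u t (g y + c t))
      (∫ t in (0 : ℝ)..T, (fderiv ℝ (u t) (g x + c t)).comp g) x := fun x hx =>
    hasFDerivAt_integral_of_continuousOn (f := fun t y => u t (g y + c t))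
      (f' := fun t y => (fderiv ℝ (u t) (g y + c t)).comp g) hV _ (hc0.comp hmap hmaps)
      ((hc1.comp hmap hmaps).clm_comp continuousOn_const)
      (fun t y hy => (hd1 t _ (hVm t y hy)).hasFDerivAt.comp y (hζd t y)) hx
  have hslice : ∀ x ∈ V, ∀ {M : Type _} [TopologicalSpace M] {f : ℝ × P → M},
      ContinuousOn f (univ ×ˢ Ω) → Continuous fun t => f (t, g x + c t) := fun x hx _ _ f hf =>
    hf.comp_continuous (f := fun t => (t, g x + c t)) (by fun_prop)
      fun t => ⟨mem_univ _, hVm t x hx⟩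
  have hF1v : ∀ x ∈ V, fderiv ℝ (fun x => a * ∫ t in (0 : ℝ)..T, u t (g x + c t)) x v =
      a * ∫ t in (0 : ℝ)..T, fderiv ℝ (u t) (g x + c t) (g v) := fun x hx => by
    have hcont : Continuous fun t => (fderiv ℝ (u t) (g x + c t)).comp g :=
      (hslice x hx hc1).clm_comp continuous_const
    rw [((hF1 x hx).const_mul a).fderiv, smul_apply, smul_eq_mul,
      ContinuousLinearMap.intervalIntegral_apply (hcont.intervalIntegrable _ _)]
    rfl
  have hF2 := hasFDerivAt_integral_of_continuousOn (T := T)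
    (f := fun t y => fderiv ℝ (u t) (g y + c t) (g v))
    (f' := fun t y => (ContinuousLinearMap.apply ℝ ℝ (g v)).comp
      ((fderiv ℝ (fderiv ℝ (u t)) (g y + c t)).comp g)) hV
    ((hc1.comp hmap hmaps).clm_apply continuousOn_const)
    (continuousOn_const.clm_comp ((hc2.comp hmap hmaps).clm_comp continuousOn_const))
    (fun t y hy => (ContinuousLinearMap.apply ℝ ℝ (g v)).hasFDerivAt.comp y
      ((hd2 t _ (hVm t y hy)).hasFDerivAt.comp y (hζd t y))) hx₀
  have heq : (fun y => fderiv ℝ (fun x => a * ∫ t in (0 : ℝ)..T, u t (g x + c t)) y v) =ᶠ[𝓝 x₀]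
      fun y => a * ∫ t in (0 : ℝ)..T, fderiv ℝ (u t) (g y + c t) (g v) := by
    filter_upwards [hV.mem_nhds hx₀] with y hy
    exact hF1v y hy
  have hcont : Continuous fun t => (ContinuousLinearMap.apply ℝ ℝ (g v)).comp
      ((fderiv ℝ (fderiv ℝ (u t)) (g x₀ + c t)).comp g) :=
    continuous_const.clm_comp ((hslice x₀ hx₀ hc2).clm_comp continuous_const)
  rw [heq.fderiv_eq, (hF2.const_mul a).fderiv, smul_apply, smul_eq_mul,
    ContinuousLinearMap.intervalIntegral_apply (hcont.intervalIntegrable _ _)]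
  rfl

end SecondDerivative

/-! ### The Hessian of the averaged perturbation -/

section Average

variable {d : ℕ} {I : Set ℝ} {D : ℝ → Set ((Fin d → ℝ) × (Fin d → ℝ))}
  {U : ℝ → Phase d → ℝ}

/-- The inclusion of the variables `(θ, q, p)` in the phase space. -/
noncomputable def embed (d : ℕ) : (ℝ × (Fin d → ℝ) × (Fin d → ℝ)) →L[ℝ] Phase d :=
  (ContinuousLinearMap.fst ℝ ℝ ((Fin d → ℝ) × (Fin d → ℝ))).prod
    (((ContinuousLinearMap.fst ℝ (Fin d → ℝ) (Fin d → ℝ)).comp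
      (ContinuousLinearMap.snd ℝ ℝ ((Fin d → ℝ) × (Fin d → ℝ)))).prod
    ((0 : (ℝ × (Fin d → ℝ) × (Fin d → ℝ)) →L[ℝ] ℝ).prod
      ((ContinuousLinearMap.snd ℝ (Fin d → ℝ) (Fin d → ℝ)).comp
        (ContinuousLinearMap.snd ℝ ℝ ((Fin d → ℝ) × (Fin d → ℝ))))))

lemma embed_apply (x : ℝ × (Fin d → ℝ) × (Fin d → ℝ)) :
    embed d x = (x.1, x.2.1, 0, x.2.2) := rfl

/-- The Hessian of the average is the average of the Hessian. -/
lemma hessian_average (hΩ : IsOpen (phaseSpace I D)) (hU : IsC03 U (phaseSpace I D))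
    (N : ℤ) (rN θs : ℝ) (qs ps : Fin d → ℝ) {z₀ : ℝ → Phase d}
    (hz₀ : ∀ t, z₀ t = (θs + N * t, qs, rN, ps)) (hmem : z₀ 0 ∈ phaseSpace I D)
    (i j : Unit ⊕ Fin d ⊕ Fin d) :
    hessian (average U N rN) (θs, qs, ps) i j = (1 / (2 * Real.pi)) *
      ∫ t in (0 : ℝ)..(2 * Real.pi),
        fderiv ℝ (fderiv ℝ (U t)) (z₀ t) (embed d (stdVec i)) (embed d (stdVec j)) := by
  set c : ℝ → Phase d := fun t => (N * t, 0, rN, 0) with hc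
  have hζ : ∀ t x, embed d x + c t = (x.1 + N * t, x.2.1, rN, x.2.2) := fun t x => by
    simp [hc, embed_apply]
  have hVo : IsOpen ((fun x => embed d x + c 0) ⁻¹' phaseSpace I D) :=
    hΩ.preimage (by fun_prop)
  -- Membership in `Ω` ignores the angle, the only component of `c t` that moves, so one open set
  -- serves all times.
  have hVm : ∀ t, ∀ x ∈ (fun x => embed d x + c 0) ⁻¹' phaseSpace I D,
      embed d x + c t ∈ phaseSpace I D := fun t x hx => by
    rw [mem_preimage, hζ] at hx
    rw [hζ]
    exact hx
  have hx₀ : ((θs, qs, ps) : ℝ × (Fin d → ℝ) × (Fin d → ℝ)) ∈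
      (fun x => embed d x + c 0) ⁻¹' phaseSpace I D := by
    rw [mem_preimage, hζ]
    rwa [hz₀] at hmem
  obtain ⟨hc0, hc1, hc2, -⟩ := hU.continuousOn_fderiv
  have := fderiv_fderiv_integral_affine hVo hc0 hc1 hc2
    (fun t z hz => (hU.differentiableAt hΩ t hz).1)
    (fun t z hz => (hU.differentiableAt hΩ t hz).2.1) (embed d) (c := c) (by fun_prop) hVm
    (1 / (2 * Real.pi)) (2 * Real.pi) hx₀ (stdVec j) (stdVec i)
  simp only [hζ] at this
  simp only [hz₀]
  exact this

end Average

/-! ### Coordinates adapted to the splitting into `r` and `(θ, q, p)` -/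

section Coordinates

variable {d : ℕ}

/-- Linear coordinates on the phase space, in the order `r`, `θ`, `q`, `p`. -/
def phaseEquiv (d : ℕ) : Phase d ≃ₗ[ℝ] (Unit ⊕ (Unit ⊕ Fin d ⊕ Fin d) → ℝ) where
  toFun z := Sum.elim (fun _ => z.2.2.1) (Sum.elim (fun _ => z.1) (Sum.elim z.2.1 z.2.2.2))
  map_add' x y := by ext (_ | _ | _ | _) <;> rfl
  map_smul' c x := by ext (_ | _ | _ | _) <;> rfl
  invFun f := (f (Sum.inr (Sum.inl ())), fun i => f (Sum.inr (Sum.inr (Sum.inl i))),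
    f (Sum.inl ()), fun i => f (Sum.inr (Sum.inr (Sum.inr i))))
  left_inv z := rfl
  right_inv f := by ext (_ | _ | _ | _) <;> rfl

lemma phaseEquiv_apply (z : Phase d) : phaseEquiv d z =
    Sum.elim (fun _ => z.2.2.1) (Sum.elim (fun _ => z.1) (Sum.elim z.2.1 z.2.2.2)) := rfl

/-- The standard basis of the phase space. -/
noncomputable def phaseBasis (d : ℕ) : Module.Basis (Unit ⊕ (Unit ⊕ Fin d ⊕ Fin d)) ℝ (Phase d) :=
  Module.Basis.ofEquivFun (phaseEquiv d)

lemma phaseBasis_inl : phaseBasis d (Sum.inl ()) = (0, 0, 1, 0) := by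
  rw [phaseBasis, Module.Basis.coe_ofEquivFun]
  change (phaseEquiv d).symm (Pi.single (Sum.inl ()) 1) = _
  rw [LinearEquiv.symm_apply_eq]
  ext (_ | _ | _ | _) <;> simp [phaseEquiv_apply]

lemma phaseBasis_inr (k : Unit ⊕ Fin d ⊕ Fin d) :
    phaseBasis d (Sum.inr k) = embed d (stdVec k) := by
  rw [phaseBasis, Module.Basis.coe_ofEquivFun]
  change (phaseEquiv d).symm (Pi.single (Sum.inr k) 1) = _
  rw [LinearEquiv.symm_apply_eq]
  rcases k with _ | k | k <;> ext (_ | _ | i | i) <;>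
    simp [phaseEquiv_apply, embed_apply, stdVec, Pi.single_apply]

/-- The coordinate functionals. -/
noncomputable def phaseCoord (i : Unit ⊕ (Unit ⊕ Fin d ⊕ Fin d)) : Phase d →L[ℝ] ℝ :=
  LinearMap.toContinuousLinearMap ((LinearMap.proj i).comp (phaseEquiv d).toLinearMap)

lemma phaseCoord_apply (i : Unit ⊕ (Unit ⊕ Fin d ⊕ Fin d)) (z : Phase d) :
    phaseCoord i z = phaseEquiv d z i := rfl

lemma toMatrix_phaseBasis (f : Phase d →ₗ[ℝ] Phase d) (i j : Unit ⊕ (Unit ⊕ Fin d ⊕ Fin d)) :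
    LinearMap.toMatrix (phaseBasis d) (phaseBasis d) f i j =
      phaseCoord i (f (phaseBasis d j)) := by
  rw [LinearMap.toMatrix_apply, phaseBasis, Module.Basis.ofEquivFun_repr_apply]
  rfl

lemma actionCoord_embed (x : ℝ × (Fin d → ℝ) × (Fin d → ℝ)) :
    actionCoord d (embed d x) = 0 := rfl

/-- The inverse of the complex structure that maps the gradient to the symplectic gradient. -/
noncomputable def invComplexStructure (d : ℕ) : Phase d →L[ℝ] Phase d :=
  LinearMap.toContinuousLinearMap
    { toFun := fun z => (-z.2.2.1, -z.2.2.2, z.1, z.2.1)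
      map_add' := fun x y => by ext <;> simp [add_comm]
      map_smul' := fun c x => by ext <;> simp }

lemma invComplexStructure_apply (z : Phase d) :
    invComplexStructure d z = (-z.2.2.1, -z.2.2.2, z.1, z.2.1) := rfl

/-- `J⁻¹` undoes the symplectic rotation, which turns the first order part of the monodromy into the
Hessian itself. -/
lemma invComplexStructure_symplecticGrad (f : Phase d →L[ℝ] ℝ)
    (k : Unit ⊕ Fin d ⊕ Fin d) :
    phaseCoord (Sum.inr k) (invComplexStructure d (symplecticGrad d f)) =
      f (embed d (stdVec k)) := by
  rw [phaseCoord_apply, invComplexStructure_apply, symplecticGrad_apply]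
  rcases k with _ | k | k <;> simp [phaseEquiv_apply, embed_apply, stdVec]

lemma det_invComplexStructure_pos :
    0 < LinearMap.det (invComplexStructure d : Phase d →ₗ[ℝ] Phase d) :=
  det_pos_of_comp_self_eq_neg fun x => by
    simp only [ContinuousLinearMap.coe_coe, invComplexStructure_apply]
    ext <;> simp

lemma eval_charpoly_eq_det (f : Phase d →ₗ[ℝ] Phase d) (x : ℝ) :
    f.charpoly.eval x = (Matrix.scalar (Unit ⊕ (Unit ⊕ Fin d ⊕ Fin d)) x -
      LinearMap.toMatrix (phaseBasis d) (phaseBasis d) f).det := by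
  rw [← LinearMap.charpoly_toMatrix f (phaseBasis d), Matrix.eval_charpoly]

end Coordinates

/-! ### Real multipliers larger than one -/

section Multiplier

variable {d : ℕ} {T α : ℝ} {g : ℝ → ℝ → ℝ} {Q : ℝ → Phase d →L[ℝ] Phase d →L[ℝ] ℝ}
  {B Φ : ℝ → ℝ → Phase d →L[ℝ] Phase d}

namespace NilpotentPerturbation

/-- Vectors without `r`-component are fixed by the unperturbed flow, so the shear term `t α ρ(x)
∂_θ` drops out of the integrand. -/
lemma tendsto_coord_monodromy_embed
    (H : NilpotentPerturbation (angleVec d) (actionCoord d) T α g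
      (fun t => -(symplecticGrad d).comp (Q t)) B Φ) {ℓ : Phase d →L[ℝ] ℝ}
    (hℓ : ℓ (angleVec d) = 0) (j : Unit ⊕ Fin d ⊕ Fin d) :
    Tendsto (fun ε => ε⁻¹ * ℓ (Φ ε T (phaseBasis d (Sum.inr j)) - phaseBasis d (Sum.inr j)))
      (𝓝[>] 0) (𝓝 (-∫ t in (0 : ℝ)..T,
        ℓ (symplecticGrad d (Q t (embed d (stdVec j)))))) := by
  have := H.tendsto_inv_smul_monodromy hℓ (phaseBasis d (Sum.inr j))
  simp only [phaseBasis_inr, actionCoord_embed, mul_zero, zero_smul, add_zero, neg_apply,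
    ContinuousLinearMap.comp_apply, map_neg, intervalIntegral.integral_neg] at this
  simpa only [phaseBasis_inr] using this

/-- A positive real multiplier larger than one from the sign of the determinant of the averaged
Hessian. -/
lemma eventually_exists_multiplier_of_det
    (H : NilpotentPerturbation (angleVec d) (actionCoord d) T α g
      (fun t => -(symplecticGrad d).comp (Q t)) B Φ) (hT : 0 < T)
    (hdet : 0 < α * (Matrix.of fun i j => ∫ t in (0 : ℝ)..T,
      Q t (embed d (stdVec i)) (embed d (stdVec j))).det) :
    ∀ᶠ ε in 𝓝[>] (0 : ℝ), ∃ y : ℝ, 1 < y ∧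
      ((Φ ε T : Phase d →ₗ[ℝ] Phase d).charpoly).IsRoot y := by
  set 𝒦 := invComplexStructure d
  set Hm : Matrix (Unit ⊕ Fin d ⊕ Fin d) (Unit ⊕ Fin d ⊕ Fin d) ℝ :=
    Matrix.of fun i j => ∫ t in (0 : ℝ)..T, Q t (embed d (stdVec i)) (embed d (stdVec j))
    with hHm
  set f : ℝ → Phase d →ₗ[ℝ] Phase d := fun ε => LinearMap.id - (Φ ε T : Phase d →ₗ[ℝ] Phase d)
  set W := fun ε => LinearMap.toMatrix (phaseBasis d) (phaseBasis d)
    ((𝒦 : Phase d →ₗ[ℝ] Phase d) ∘ₗ f ε)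
  have hW : ∀ ε i j, W ε i j = -((phaseCoord i).comp 𝒦)
      (Φ ε T (phaseBasis d j) - phaseBasis d j) := fun ε i j => by
    simp only [W, toMatrix_phaseBasis, f]
    simp
  -- `𝒦` sends `∂_θ` to the `r`-axis: the contribution of order one occupies only the `r`-row, and
  -- the first order expansion applies to the others.
  have hkill : ∀ k, ((phaseCoord (Sum.inr k)).comp 𝒦) (angleVec d) = 0 := fun k => by
    rcases k with _ | k | k <;>
      simp [𝒦, phaseCoord_apply, invComplexStructure_apply, angleVec, phaseEquiv_apply]
  have hsub : ∀ j, Tendsto (fun ε => Φ ε T (phaseBasis d j) - phaseBasis d j) (𝓝[>] 0)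
      (𝓝 ((T * α * actionCoord d (phaseBasis d j)) • angleVec d)) := fun j => by
    simpa using (H.tendsto_monodromy (phaseBasis d j)).sub_const (phaseBasis d j)
  have h0 : ∀ j, Tendsto (fun ε => W ε (Sum.inl ()) j) (𝓝[>] 0)
      (𝓝 (-(T * α * actionCoord d (phaseBasis d j)))) := fun j => by
    simp only [hW]
    have h1 := ((((phaseCoord (Sum.inl ())).comp 𝒦).continuous.tendsto _).comp (hsub j)).neg
    have h2 : ((phaseCoord (Sum.inl ())).comp 𝒦) (angleVec d) = 1 := by
      simp [𝒦, phaseCoord_apply, invComplexStructure_apply, angleVec, phaseEquiv_apply]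
    rwa [map_smul, h2, smul_eq_mul, mul_one] at h1
  -- The limit block appears transposed; the determinant does not see this, so symmetry of the
  -- second derivative is not needed.
  have hneg := eventually_det_neg_of_rows (W := W) (a := -(T * α)) (K := Hm.transpose)
    (c := fun i => -∫ t in (0 : ℝ)..T, ((phaseCoord (Sum.inr i)).comp 𝒦)
      ((-(symplecticGrad d).comp (Q t)) (phaseBasis d (Sum.inl ()) +
        (t * α * actionCoord d (phaseBasis d (Sum.inl ()))) • angleVec d)))
    (by simpa [phaseBasis_inl] using h0 (Sum.inl ()))
    (fun j => by
      have h1 := h0 (Sum.inr j)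
      rwa [phaseBasis_inr, actionCoord_embed, mul_zero, neg_zero] at h1)
    (fun i => by
      simp only [hW, mul_neg]
      exact (H.tendsto_inv_smul_monodromy (hkill i) _).neg)
    (fun i j => by
      simp only [hW, mul_neg]
      have h1 := (H.tendsto_coord_monodromy_embed (hkill i) j).neg
      rw [neg_neg] at h1
      convert h1 using 2
      rw [Matrix.transpose_apply, hHm, Matrix.of_apply]
      refine intervalIntegral.integral_congr fun t _ => ?_
      exact (invComplexStructure_symplecticGrad _ _).symm)
    (by rw [Matrix.det_transpose]; nlinarith)
  filter_upwards [hneg] with ε hε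
  refine exists_isRoot_gt_of_eval_neg (LinearMap.charpoly_monic _) ?_
  have h1 : (Matrix.scalar (Unit ⊕ (Unit ⊕ Fin d ⊕ Fin d)) (1 : ℝ)) =
      LinearMap.toMatrix (phaseBasis d) (phaseBasis d) LinearMap.id := by
    rw [map_one, LinearMap.toMatrix_id]
  rw [eval_charpoly_eq_det, h1, ← map_sub, LinearMap.det_toMatrix]
  simp only [W, LinearMap.det_toMatrix, LinearMap.det_comp] at hε
  by_contra! hcon
  exact absurd hε (not_lt.2 (mul_nonneg det_invComplexStructure_pos.le hcon))

/-- A positive real multiplier larger than one from the sign of the second angular derivative of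
the averaged perturbation. -/
lemma eventually_exists_multiplier_of_angle
    (H : NilpotentPerturbation (angleVec d) (actionCoord d) T α g
      (fun t => -(symplecticGrad d).comp (Q t)) B Φ)
    (hang : 0 < T * α * ∫ t in (0 : ℝ)..T, Q t (angleVec d) (angleVec d)) :
    ∀ᶠ ε in 𝓝[>] (0 : ℝ), ∃ y : ℝ, 1 < y ∧
      ((Φ ε T : Phase d →ₗ[ℝ] Phase d).charpoly).IsRoot y := by
  set S := T * α * ∫ t in (0 : ℝ)..T, Q t (angleVec d) (angleVec d) with hS
  obtain ⟨ν, hν, hνS⟩ : ∃ ν > 0, ν ^ 2 < S := by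
    refine ⟨√(S / 2), Real.sqrt_pos.2 (by positivity), ?_⟩
    rw [Real.sq_sqrt (by positivity)]
    linarith
  set W := fun ε => LinearMap.toMatrix (phaseBasis d) (phaseBasis d)
    ((Φ ε T : Phase d →ₗ[ℝ] Phase d) - LinearMap.id)
  have hW : ∀ ε i j, W ε i j = phaseCoord i
      (Φ ε T (phaseBasis d j) - phaseBasis d j) := fun ε i j => by
    simp only [W, toMatrix_phaseBasis]
    simp
  have hkill : phaseCoord (Sum.inl ()) (angleVec d) = 0 := by
    simp [phaseCoord_apply, angleVec, phaseEquiv_apply]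
  -- Of the column `γ` only the `θ`-entry `T * α` survives, so `∑ j, β j * γ j` reduces to `S`.
  have hneg := eventually_det_sub_neg (W := W) (ν := ν)
    (β := fun j => ∫ t in (0 : ℝ)..T, Q t (embed d (stdVec j)) (angleVec d))
    (γ := fun i => T * α * phaseCoord (Sum.inr i) (angleVec d))
    (by
      simp only [hW]
      exact H.tendsto_inv_smul_monodromy hkill _)
    (fun j => by
      simp only [hW]
      convert H.tendsto_coord_monodromy_embed hkill j using 2
      rw [← intervalIntegral.integral_neg]
      refine intervalIntegral.integral_congr fun t _ => ?_
      simp [phaseCoord_apply, symplecticGrad_apply, angleVec, phaseEquiv_apply])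
    (fun i => by
      simp only [hW]
      have h1 := (H.tendsto_monodromy (phaseBasis d (Sum.inl ()))).sub_const
        (phaseBasis d (Sum.inl ()))
      have h2 := ((phaseCoord (Sum.inr i)).continuous.tendsto _).comp h1
      rw [add_sub_cancel_left, map_smul, smul_eq_mul, phaseBasis_inl] at h2
      simpa [phaseBasis_inl, Function.comp_def] using h2)
    (fun i j => by
      obtain ⟨C, hC⟩ := H.exists_norm_monodromy_sub_le
        (x := phaseBasis d (Sum.inr j)) (by rw [phaseBasis_inr]; rfl)
      refine ⟨‖phaseCoord (d := d) (Sum.inr i)‖ * C, ?_⟩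
      filter_upwards [hC] with ε hε
      rw [hW, ← Real.norm_eq_abs, mul_assoc]
      exact (ContinuousLinearMap.le_opNorm _ _).trans (by gcongr))
    hν (by
      refine hνS.trans_eq ?_
      rw [Finset.sum_eq_single (Sum.inl ())]
      · have h1 : phaseCoord (d := d) (Sum.inr (Sum.inl ())) (angleVec d) = 1 := rfl
        have h2 : embed d (stdVec (Sum.inl ())) = angleVec d := rfl
        rw [h1, h2, hS]
        ring
      · rintro (⟨⟩ | k | k) - hk
        · exact absurd rfl hk
        · simp [phaseCoord_apply, angleVec, phaseEquiv_apply]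
        · simp [phaseCoord_apply, angleVec, phaseEquiv_apply]
      · exact fun h => absurd (Finset.mem_univ _) h)
  filter_upwards [hneg, self_mem_nhdsWithin] with ε hε hε0
  have hs : 0 < √ε := Real.sqrt_pos.2 hε0
  have h1 : (Φ ε T : Phase d →ₗ[ℝ] Phase d).charpoly.eval (1 + √ε * ν) < 0 := by
    refine lt_of_eq_of_lt ?_ hε
    rw [eval_charpoly_eq_det]
    simp only [W, map_sub, LinearMap.toMatrix_id]
    rw [map_add, map_one]
    congr 1
    abel
  obtain ⟨y, hy, hroot⟩ := exists_isRoot_gt_of_eval_neg (LinearMap.charpoly_monic _) h1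
  exact ⟨y, lt_trans (by linarith [mul_pos hs hν]) hy, hroot⟩

end NilpotentPerturbation

end Multiplier

/-! ### The variational equations along the family -/

section Family

variable {d : ℕ} {I : Set ℝ} {D : ℝ → Set ((Fin d → ℝ) × (Fin d → ℝ))} {h : ℝ → ℝ}
  {U : ℝ → Phase d → ℝ}

lemma symplecticGrad_comp_hamiltonianHessian (ε t : ℝ) (z : Phase d) :
    (symplecticGrad d).comp (hamiltonianHessian h U ε t z) =
      deriv (deriv h) z.2.2.1 • (actionCoord d).smulRight (angleVec d) +
        ε • -((symplecticGrad d).comp (fderiv ℝ (fderiv ℝ (U t)) z)) := by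
  refine ContinuousLinearMap.ext fun x => ?_
  simp only [hamiltonianHessian, ContinuousLinearMap.comp_apply, smul_apply, add_apply, neg_apply, ContinuousLinearMap.smulRight_apply, map_add, map_neg,
    map_smul, symplecticGrad_actionCoord, smul_neg, sub_eq_add_neg]

lemma variationalCoeff_eq (hI : IsOpen I) (hΩ : IsOpen (phaseSpace I D))
    (hh : ContDiffOn ℝ 3 h I) (hU : IsC03 U (phaseSpace I D)) {ε : ℝ} {z : ℝ → Phase d}
    (hz : ∀ t, z t ∈ phaseSpace I D) (t : ℝ) :
    variationalCoeff (field h U ε) z t =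
      deriv (deriv h) (z t).2.2.1 • (actionCoord d).smulRight (angleVec d) +
        ε • -((symplecticGrad d).comp (fderiv ℝ (fderiv ℝ (U t)) (z t))) := by
  rw [variationalCoeff, (hasFDerivAt_field hI hΩ hh hU ε t (hz t)).fderiv,
    symplecticGrad_comp_hamiltonianHessian]

lemma exists_monodromy (hI : IsOpen I) (hΩ : IsOpen (phaseSpace I D))
    (hh : ContDiffOn ℝ 3 h I) (hU : IsC03 U (phaseSpace I D)) {ε : ℝ} {z : ℝ → Phase d}
    (hz : IsPeriodicSolution (field h U ε) (phaseSpace I D) z) :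
    ∃ Φ : ℝ → Phase d →L[ℝ] Phase d, Φ 0 = ContinuousLinearMap.id ℝ (Phase d) ∧
      ∀ t, HasDerivAt Φ ((variationalCoeff (field h U ε) z t).comp (Φ t)) t := by
  have hzc : Continuous z := continuous_iff_continuousAt.2 fun t => (hz.hasDerivAt t).continuousAt
  have hA : Continuous (variationalCoeff (field h U ε) z) := by
    have h1 : Continuous fun t => hamiltonianHessian h U ε t (z t) :=
      (continuousOn_hamiltonianHessian hI hh hU ε).comp_continuous (f := fun t => (t, z t))
        (by fun_prop) fun t => ⟨mem_univ _, hz.mem t⟩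
    refine (continuous_const.clm_comp h1 : Continuous fun t =>
      (symplecticGrad d).comp (hamiltonianHessian h U ε t (z t))).congr fun t => ?_
    rw [variationalCoeff, (hasFDerivAt_field hI hΩ hh hU ε t (hz.mem t)).fderiv]
  exact exists_fundamental_solution hA

/-- The variational equations along a continuous family of periodic solutions that issues from a
resonant torus. -/
lemma nilpotentPerturbation_of_family (hI : IsOpen I) (hΩ : IsOpen (phaseSpace I D))
    (hh : ContDiffOn ℝ 3 h I) (hU : IsC03 U (phaseSpace I D)) {rN ε₀ : ℝ} (hε₀ : 0 < ε₀)
    {z : ℝ → ℝ → Phase d}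
    (hzc : ContinuousOn (fun x : ℝ × ℝ => z x.1 x.2) (univ ×ˢ Ioo (-ε₀) ε₀))
    (hmem : ∀ ε ∈ Ioo (-ε₀) ε₀, ∀ t, z t ε ∈ phaseSpace I D)
    (hr : ∀ t, (z t 0).2.2.1 = rN) {Φ : ℝ → ℝ → Phase d →L[ℝ] Phase d}
    (hΦ0 : ∀ ε ∈ Ioo (-ε₀) ε₀, Φ ε 0 = ContinuousLinearMap.id ℝ (Phase d))
    (hΦ : ∀ ε ∈ Ioo (-ε₀) ε₀, ∀ t, HasDerivAt (Φ ε)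
      ((variationalCoeff (field h U ε) (fun t => z t ε) t).comp (Φ ε t)) t) :
    NilpotentPerturbation (angleVec d) (actionCoord d) (2 * Real.pi) (deriv (deriv h) rN)
      (fun ε t => deriv (deriv h) (z t ε).2.2.1)
      (fun t => -(symplecticGrad d).comp (fderiv ℝ (fderiv ℝ (U t)) (z t 0)))
      (fun ε t => -(symplecticGrad d).comp (fderiv ℝ (fderiv ℝ (U t)) (z t ε))) Φ := by
  have h0 : (0 : ℝ) ∈ Ioo (-ε₀) ε₀ := by simpa using hε₀
  have hev : ∀ᶠ ε in 𝓝[>] (0 : ℝ), ε ∈ Ioo (-ε₀) ε₀ :=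
    nhdsWithin_le_nhds (isOpen_Ioo.mem_nhds h0)
  have hB : ContinuousOn (fun x : ℝ × ℝ =>
      -(symplecticGrad d).comp (fderiv ℝ (fderiv ℝ (U x.1)) (z x.1 x.2)))
      (univ ×ˢ Ioo (-ε₀) ε₀) :=
    (continuousOn_const.clm_comp (hU.continuousOn_fderiv.2.2.1.comp
      (f := fun x : ℝ × ℝ => (x.1, z x.1 x.2)) (continuousOn_fst.prodMk hzc)
      fun x hx => ⟨mem_univ _, hmem _ hx.2 _⟩)).neg
  have hg : ContinuousOn (fun x : ℝ × ℝ => deriv (deriv h) (z x.1 x.2).2.2.1)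
      (univ ×ˢ Ioo (-ε₀) ε₀) := by
    have h2 : ContDiffOn ℝ 2 (deriv h) I := hh.deriv_of_isOpen hI (by norm_num)
    have h3 : ContDiffOn ℝ 1 (deriv (deriv h)) I := h2.deriv_of_isOpen hI (by norm_num)
    exact h3.continuousOn.comp (f := fun x : ℝ × ℝ => (z x.1 x.2).2.2.1) (by fun_prop)
      fun x hx => (hmem _ hx.2 _).1
  refine ⟨rfl, Real.two_pi_pos.le, ?_, fun η hη => ?_, fun η hη => ?_, ?_, ?_⟩
  · exact hB.comp_continuous (f := fun t => (t, (0 : ℝ))) (by fun_prop)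
      fun t => ⟨mem_univ _, h0⟩
  · filter_upwards [nhdsWithin_le_nhds
      (eventually_forall_dist_le_of_continuousOn hε₀ hg (2 * Real.pi) hη)] with ε h1 t ht
    have := h1 t ht
    rwa [hr, Real.dist_eq] at this
  · filter_upwards [nhdsWithin_le_nhds
      (eventually_forall_dist_le_of_continuousOn hε₀ hB (2 * Real.pi) hη)] with ε h1 t ht
    have := h1 t ht
    rwa [dist_eq_norm] at this
  · exact hev.mono hΦ0
  · refine hev.mono fun ε hε t => ?_
    rw [← variationalCoeff_eq hI hΩ hh hU (z := fun t => z t ε) (hmem ε hε) t]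
    exact hΦ ε hε t

end Family

end DegenerateHamiltonian

/-! ### The theorem -/

open DegenerateHamiltonian

theorem proposition5p1 (d : ℕ) (I : Set ℝ) (hI_open : IsOpen I) (hI_conn : I.OrdConnected)
    (D : ℝ → Set ((Fin d → ℝ) × (Fin d → ℝ)))
    (hΩ : IsOpen (DegenerateHamiltonian.phaseSpace I D))
    (h : ℝ → ℝ) (hh : ContDiffOn ℝ 3 h I)
    (U : ℝ → DegenerateHamiltonian.Phase d → ℝ)
    (hU : DegenerateHamiltonian.IsC03 U (DegenerateHamiltonian.phaseSpace I D))
    (N : ℤ) (rN : ℝ) (hrN : rN ∈ I)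
    (hN : deriv h rN = N) (hN' : deriv (deriv h) rN ≠ 0)
    (θs : ℝ) (qs ps : Fin d → ℝ)
    (ε₀ : ℝ) (hε₀ : 0 < ε₀)
    (z : ℝ → ℝ → DegenerateHamiltonian.Phase d)
    (hz_smooth : ContDiffOn ℝ 1 (fun x : ℝ × ℝ => z x.1 x.2) (univ ×ˢ Ioo (-ε₀) ε₀))
    (hz_sol : ∀ ε ∈ Ioo (-ε₀) ε₀,
      DegenerateHamiltonian.IsPeriodicSolution (DegenerateHamiltonian.field h U ε)
        (DegenerateHamiltonian.phaseSpace I D) (fun t => z t ε))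
    (hz_zero : ∀ t, z t 0 = (θs + N * t, qs, rN, ps))
    (hcond :
      0 < deriv (deriv h) rN *
          DegenerateHamiltonian.secondAngleDeriv
            (DegenerateHamiltonian.average U N rN) (θs, qs, ps) ∨
      0 < deriv (deriv h) rN *
          (DegenerateHamiltonian.hessian
            (DegenerateHamiltonian.average U N rN) (θs, qs, ps)).det) :
    ∃ ε₁ : ℝ, 0 < ε₁ ∧ ε₁ ≤ ε₀ ∧ ∀ ε ∈ Ioo 0 ε₁,
      (∃ μ : ℂ, 1 < ‖μ‖ ∧
        DegenerateHamiltonian.IsFloquetMultiplier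
          (DegenerateHamiltonian.variationalCoeff
            (DegenerateHamiltonian.field h U ε) (fun t => z t ε)) μ) ∧
      ¬ DegenerateHamiltonian.LyapunovStable (DegenerateHamiltonian.field h U ε)
          (DegenerateHamiltonian.phaseSpace I D) (fun t => z t ε) := by

  have h0 : (0 : ℝ) ∈ Ioo (-ε₀) ε₀ := by simpa using hε₀
  have hΦex : ∀ ε, ∃ Φ : ℝ → Phase d →L[ℝ] Phase d, ε ∈ Ioo (-ε₀) ε₀ →
      Φ 0 = ContinuousLinearMap.id ℝ (Phase d) ∧
      ∀ t, HasDerivAt Φ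
        ((variationalCoeff (field h U ε) (fun t => z t ε) t).comp (Φ t)) t := fun ε => by
    by_cases hε : ε ∈ Ioo (-ε₀) ε₀
    · obtain ⟨Φ, hΦ⟩ := exists_monodromy hI_open hΩ hh hU (hz_sol ε hε)
      exact ⟨Φ, fun _ => hΦ⟩
    · exact ⟨fun _ => 0, fun h => absurd h hε⟩
  choose Φ hΦ using hΦex
  have H := nilpotentPerturbation_of_family (rN := rN) hI_open hΩ hh hU hε₀
    hz_smooth.continuousOn (fun ε hε => (hz_sol ε hε).mem) (fun t => by rw [hz_zero])
    (fun ε hε => (hΦ ε hε).1) (fun ε hε => (hΦ ε hε).2)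
  have hhess := hessian_average hΩ hU N rN θs qs ps hz_zero ((hz_sol 0 h0).mem 0)
  have hpi := Real.two_pi_pos
  have hmult : ∀ᶠ ε in 𝓝[>] (0 : ℝ), ∃ y : ℝ, 1 < y ∧
      ((Φ ε (2 * Real.pi) : Phase d →ₗ[ℝ] Phase d).charpoly).IsRoot y := by
    rcases hcond with hc | hc
    · refine H.eventually_exists_multiplier_of_angle ?_
      rw [secondAngleDeriv, hhess] at hc
      have h1 : embed d (stdVec (Sum.inl ())) = angleVec d := rfl
      rw [h1, mul_left_comm] at hc
      have h2 := pos_of_mul_pos_right hc (by positivity)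
      rw [mul_assoc]
      exact mul_pos hpi h2
    · refine H.eventually_exists_multiplier_of_det hpi ?_
      have h1 : hessian (average U N rN) (θs, qs, ps) = (1 / (2 * Real.pi)) •
          (Matrix.of fun i j => ∫ t in (0 : ℝ)..(2 * Real.pi),
            fderiv ℝ (fderiv ℝ (U t)) (z t 0) (embed d (stdVec i)) (embed d (stdVec j))) := by
        ext i j
        exact hhess i j
      -- The normalization `1 / (2π)` enters the determinant as a positive power, so the sign
      -- condition passes to the integrated Hessian.
      rw [h1, Matrix.det_smul, mul_left_comm] at hc
      exact pos_of_mul_pos_right hc (by positivity)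
  obtain ⟨ε₂, hε₂, hsub⟩ := mem_nhdsGT_iff_exists_Ioo_subset.1 hmult
  refine ⟨min ε₂ ε₀, lt_min hε₂ hε₀, min_le_right _ _, fun ε hε => ?_⟩
  have hεI : ε ∈ Ioo (-ε₀) ε₀ :=
    ⟨by linarith [hε.1], hε.2.trans_le (min_le_right _ _)⟩
  obtain ⟨y, hy, hroot⟩ := hsub ⟨hε.1, hε.2.trans_le (min_le_left _ _)⟩
  have hy' : 1 < ‖(y : ℂ)‖ := by
    rw [Complex.norm_real, Real.norm_eq_abs]
    exact hy.trans_le (le_abs_self y)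
  have hF : IsFloquetMultiplier (variationalCoeff (field h U ε) (fun t => z t ε)) (y : ℂ) :=
    ⟨Φ ε, (hΦ ε hεI).1, (hΦ ε hεI).2, hroot.map (f := algebraMap ℝ ℂ)⟩
  exact ⟨⟨y, hy', hF⟩, (hz_sol ε hεI).not_lyapunovStable hI_open hΩ hh hU hy' hF⟩
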